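/- Let $b$ be an integer that is not divisible by the sixth power of any prime and such that $x^6+b$ is irreducible over $\mathbb{Q}$, and let $K=\mathbb{Q}(\theta)$, where $\theta$ is a root of $x^6+b$. For a prime $p$ let $v_p(b)$ be the exponent of the highest power of $p$ dividing $b$, and put $b_2=b/2^{v_2(b)}$, $b_3=b/3^{v_3(b)}$. Then the discriminant of $K$ is $$d_K=\operatorname{sgn}(-b)\,2^{r_1}\,3^{r_2}\prod_{p\neq 2,3}p^{\,6-\gcd(6,v_p(b))},$$ where the product is over all primes $p\ne 2,3$ (a prime not dividing $b$ contributes the factor $1$, since $\gcd(6,0)=6$), and $r_1,r_2$ are given by $$r_1=\begin{cases}0&\text{if } b\equiv 3 \pmod 4,\\ 6&\text{if } b\equiv 1\pmod 4,\\ 11&\text{if } v_2(b)\in\{1,5\},\\ 9&\text{if } v_2(b)=3,\\ 4&\text{if } v_2(b)\in\{2,4\}\text{ and } b_2\equiv 3\pmod 4,\\ 8&\text{if } v_2(b)\in\{2,4\}\text{ and } b_2\equiv 1\pmod 4,\end{cases}$$ $$r_2=\begin{cases}2&\text{if } b\equiv \pm1 \pmod 9,\\ 6&\text{if } b\equiv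 \pm2\text{ or }\pm4\pmod 9,\\ 11&\text{if } v_3(b)\in\{1,5\},\\ 10&\text{if } v_3(b)\in\{2,4\},\\ 3&\text{if } v_3(b)=3\text{ and } b_3^2\equiv 1\pmod 9,\\ 7&\text{if } v_3(b)=3\text{ and } b_3^2\not\equiv 1\pmod 9.\end{cases}$$ -/

import Mathlib

/-- The part of `b` prime to `q`, that is `b / q ^ v_q(b)` (an exact division of integers). -/
def primeToPart (q : ℕ) (b : ℤ) : ℤ := b / (q : ℤ) ^ padicValInt q b

/-- The exponent of `2`. For `b ≠ 0` with `v_2(b) < 6` the listed conditions are mutually exclusive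
and exhaustive, so that the last value `0` is never reached. -/
def expTwo (b : ℤ) : ℕ :=
  if b + 1 ≡ 0 [ZMOD 4] then 0
  else if b + 1 ≡ 2 [ZMOD 4] then 6
  else if padicValInt 2 b = 1 ∨ padicValInt 2 b = 5 then 11
  else if padicValInt 2 b = 3 then 9
  else if (padicValInt 2 b = 2 ∨ padicValInt 2 b = 4) ∧ primeToPart 2 b ≡ 3 [ZMOD 4] then 4
  else if (padicValInt 2 b = 2 ∨ padicValInt 2 b = 4) ∧ primeToPart 2 b ≡ 1 [ZMOD 4] then 8
  else 0

/-- The exponent of `3`. For `b ≠ 0` with `v_3(b) < 6` the listed conditions are mutually exclusive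
and exhaustive, so that the last value `0` is never reached. -/
def expThree (b : ℤ) : ℕ :=
  if b ≡ 1 [ZMOD 9] ∨ b ≡ -1 [ZMOD 9] then 2
  else if b ≡ 2 [ZMOD 9] ∨ b ≡ -2 [ZMOD 9] ∨ b ≡ 4 [ZMOD 9] ∨ b ≡ -4 [ZMOD 9] then 6
  else if padicValInt 3 b = 1 ∨ padicValInt 3 b = 5 then 11
  else if padicValInt 3 b = 2 ∨ padicValInt 3 b = 4 then 10
  else if padicValInt 3 b = 3 ∧ primeToPart 3 b ^ 2 ≡ 1 [ZMOD 9] then 3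
  else if padicValInt 3 b = 3 ∧ ¬ primeToPart 3 b ^ 2 ≡ 1 [ZMOD 9] then 7
  else 0

/-! The powers of `θ` have discriminant `-6 ^ 6 * b ^ 5`, so everything is local: at each prime `p`
one needs the index of a lattice in `ℤ[θ]`-coordinates that is already maximal at `p`. If integral
elements are given by a lower triangular matrix of determinant `p ^ (-k)` in the powers of `θ`, and
no nontrivial `𝔽_p`-combination of them is divisible by `p` among integers, then `-6 ^ 6 * b ^ 5 = p
^ (2 * k) * d ^ 2 * d_K` with `p ∤ d` (`exists_discr_eq_sq_mul_discr`, `exists_discr_of_matrix`),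
and `v_p(d_K)` can be read off. The same relation gives the sign.

Maximality is tested through conjugates. Replacing `θ` by the complex roots `ω * s` and `-s` splits
an integral `∑ a_i θ ^ i` into pieces. The cube roots of unity isolate `(a_i + a_(i+3) θ ^ 3) θ ^ i`
at the cost of a factor 3, harmless at 2; the sign isolates the even and odd parts at the cost of a
factor 2, harmless at 3. Norms of the pieces are rational integers, and become congruences for a
binary quadratic form at 2 and for the norm form of a pure cubic field at 3. At `p ≥ 5` single
monomials can be isolated, and valuations alone suffice.

For `p = 2, 3` the explicit bases treat `v ≤ 3`. The cases `v = 4, 5` follow from `v = 2, 1`, since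
`θ ^ 5 / p ^ k` generates the same field (`pow_five_div`). -/

/-- `θ` generates the field `K` over `ℚ`, of degree six, and is a root of `x ^ 6 + b`. -/
structure IsPureSextic {K : Type*} [Field K] [NumberField K] (θ : K) (b : ℤ) : Prop where
  pow_eq : θ ^ 6 = -(b : K)
  adjoin_eq : IntermediateField.adjoin ℚ {θ} = ⊤
  finrank_eq : Module.finrank ℚ K = 6

theorem isIntegral_of_pow_eq_intCast {R : Type*} [CommRing R] {x : R} {n : ℕ} (hn : 0 < n) {m : ℤ}
    (h : x ^ n = (m : R)) : IsIntegral ℤ x := by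
  refine IsIntegral.of_pow hn ?_
  rw [h]
  exact isIntegral_algebraMap (R := ℤ) (x := m)

theorem Rat.exists_intCast_of_isIntegral {F : Type*} [Field F] [CharZero F] {q : ℚ}
    (h : IsIntegral ℤ (q : F)) : ∃ n : ℤ, (n : ℚ) = q := by
  have h' : IsIntegral ℤ (algebraMap ℚ F q) := by simpa using h
  have := (isIntegral_algebraMap_iff (algebraMap ℚ F).injective).1 h'
  obtain ⟨n, hn⟩ := IsIntegrallyClosed.isIntegral_iff.1 this
  exact ⟨n, by simpa using hn⟩

/-! ### Minimal polynomial and discriminant of the powers of `θ` -/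

namespace IsPureSextic

variable {K : Type*} [Field K] [NumberField K] {θ : K} {b : ℤ}

open Polynomial

theorem isIntegral (h : IsPureSextic θ b) : IsIntegral ℤ θ :=
  isIntegral_of_pow_eq_intCast (n := 6) (m := -b) (by norm_num) (by simpa using h.pow_eq)

theorem algebra_adjoin_eq (h : IsPureSextic θ b) : Algebra.adjoin ℚ {θ} = ⊤ := by
  have hi : IsIntegral ℚ θ := h.isIntegral.tower_top
  rw [← IntermediateField.adjoin_simple_toSubalgebra_of_isAlgebraic hi.isAlgebraic, h.adjoin_eq,
    IntermediateField.top_toSubalgebra]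

theorem natDegree_minpoly (h : IsPureSextic θ b) : (minpoly ℚ θ).natDegree = 6 := by
  have hi : IsIntegral ℚ θ := h.isIntegral.tower_top
  rw [← IntermediateField.adjoin.finrank hi, h.adjoin_eq, IntermediateField.finrank_top',
    h.finrank_eq]

theorem minpoly_eq (h : IsPureSextic θ b) : minpoly ℚ θ = X ^ 6 + C (b : ℚ) := by
  have hi : IsIntegral ℚ θ := h.isIntegral.tower_top
  have hm : (X ^ 6 + C (b : ℚ)).Monic := monic_X_pow_add_C _ (by norm_num)
  have hd : minpoly ℚ θ ∣ X ^ 6 + C (b : ℚ) := minpoly.dvd _ _ (by simp [h.pow_eq])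
  refine (eq_of_monic_of_dvd_of_natDegree_le (minpoly.monic hi) hm hd ?_).symm
  rw [natDegree_X_pow_add_C, h.natDegree_minpoly]

theorem exists_powerBasis (h : IsPureSextic θ b) :
    ∃ pb : PowerBasis ℚ K, pb.gen = θ ∧ pb.dim = 6 := by
  have hi : IsIntegral ℚ θ := h.isIntegral.tower_top
  refine ⟨PowerBasis.ofAdjoinEqTop hi h.algebra_adjoin_eq, by simp, ?_⟩
  rw [PowerBasis.ofAdjoinEqTop_dim, h.natDegree_minpoly]

/-- Up to the sign `(-1) ^ 15`, this is the norm of the derivative `6 * θ ^ 5`, where `θ` has norm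
`b`. -/
theorem discr_pow (h : IsPureSextic θ b) :
    Algebra.discr ℚ (fun i : Fin 6 => θ ^ (i : ℕ)) = -6 ^ 6 * (b : ℚ) ^ 5 := by
  obtain ⟨pb, hg, hd⟩ := h.exists_powerBasis
  have h1 : Algebra.discr ℚ (fun i : Fin 6 => θ ^ (i : ℕ)) = Algebra.discr ℚ pb.basis := by
    rw [← Algebra.discr_reindex ℚ pb.basis (finCongr hd)]
    congr 1
    ext i
    simp [hg]
  have hn : Algebra.norm ℚ pb.gen = b := by
    rw [Algebra.PowerBasis.norm_gen_eq_coeff_zero_minpoly, hg, h.minpoly_eq, hd]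
    norm_num
  rw [h1, Algebra.discr_powerBasis_eq_norm, h.finrank_eq, hg, h.minpoly_eq, ← hg]
  have : aeval pb.gen (derivative (X ^ 6 + C (b : ℚ))) = algebraMap ℚ K 6 * pb.gen ^ 5 := by
    simp
    norm_num
  rw [this, map_mul, map_pow, hn, Algebra.norm_algebraMap, h.finrank_eq]
  norm_num

/-- An integral element stays integral when `θ` is replaced by a complex root of `x ^ 6 + b`. -/
theorem isIntegral_sum_pow (h : IsPureSextic θ b) {a : Fin 6 → ℚ}
    (ha : IsIntegral ℤ (∑ i, (a i : K) * θ ^ (i : ℕ))) {s : ℂ} (hs : s ^ 6 = -(b : ℂ)) :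
    IsIntegral ℤ (∑ i, (a i : ℂ) * s ^ (i : ℕ)) := by
  obtain ⟨pb, hg, hd⟩ := h.exists_powerBasis
  have hr : aeval s (minpoly ℚ pb.gen) = 0 := by simp [hg, h.minpoly_eq, hs]
  have := map_isIntegral_int (pb.lift s hr).toRingHom ha
  have hgs : pb.lift s hr θ = s := by rw [← hg, pb.lift_gen]
  simpa [hgs] using this

theorem exists_root (b : ℤ) : ∃ s : ℂ, s ^ 6 = -(b : ℂ) :=
  IsAlgClosed.exists_pow_nat_eq _ (by norm_num)

end IsPureSextic

theorem exists_cubeRoot_one : ∃ ω : ℂ, ω ^ 2 + ω + 1 = 0 := by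
  obtain ⟨r, hr⟩ := IsAlgClosed.exists_pow_nat_eq (-3 : ℂ) (n := 2) (by norm_num)
  exact ⟨(-1 + r) / 2, by linear_combination hr / 4⟩

/-! ### Lattices maximal at a prime -/

/-- If the elements `w i` of `K` are integral and generate a lattice which is maximal at `p`, then
their discriminant differs from that of `K` by the square of an integer prime to `p`. -/
theorem exists_discr_eq_sq_mul_discr {K : Type*} [Field K] [NumberField K] {ι : Type*} [Fintype ι]
    [DecidableEq ι] (hι : Fintype.card ι = Module.finrank ℚ K) {p : ℕ} [Fact p.Prime] (w : ι → K)
    (hw : ∀ i, IsIntegral ℤ (w i))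
    (hmax : ∀ c : ι → ℤ, IsIntegral ℤ ((∑ i, (c i : K) * w i) / p) → ∀ i, (p : ℤ) ∣ c i) :
    ∃ d : ℤ, ¬ (p : ℤ) ∣ d ∧ Algebra.discr ℚ w = d ^ 2 * NumberField.discr K := by
  have hcard : Fintype.card (Module.Free.ChooseBasisIndex ℤ (NumberField.RingOfIntegers K)) =
      Fintype.card ι := by
    rw [hι, ← NumberField.RingOfIntegers.rank, Module.finrank_eq_card_chooseBasisIndex]
  let e := Fintype.equivOfCardEq hcard
  let B := (NumberField.RingOfIntegers.basis K).reindex e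
  let W : ι → NumberField.RingOfIntegers K := fun i => ⟨w i, hw i⟩
  let M : Matrix ι ι ℤ := fun i j => B.repr (W i) j
  have hM (i : ι) : w i = ∑ j, (M i j : K) * (B j : K) := by
    have := congrArg (algebraMap (NumberField.RingOfIntegers K) K) (B.sum_repr (W i))
    simp only [map_sum, zsmul_eq_mul, map_mul, map_intCast] at this
    exact this.symm
  refine ⟨M.det, ?_, ?_⟩
  · intro hdvd
    -- If `p` divided the index `M.det`, a nonzero row vector over `ZMod p` would kill `M`. Its lift
    -- `c` makes `∑ c i * w i` divisible by `p` among the integers of `K`, which `hmax` forbids.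
    have h0 : (M.map (Int.castRingHom (ZMod p))).det = 0 := by
      rw [← RingHom.mapMatrix_apply, ← RingHom.map_det]
      simpa using (ZMod.intCast_zmod_eq_zero_iff_dvd M.det p).2 hdvd
    obtain ⟨v, hv0, hv⟩ := Matrix.exists_vecMul_eq_zero_iff.2 h0
    choose c hc using fun i => ZMod.intCast_surjective (v i)
    have hdiv (j : ι) : (p : ℤ) ∣ ∑ i, c i * M i j := by
      rw [← ZMod.intCast_zmod_eq_zero_iff_dvd]
      have := congrFun hv j
      simpa [Matrix.vecMul, dotProduct, hc] using this
    choose q hq using hdiv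
    have hp0 : (p : K) ≠ 0 := by exact_mod_cast (Fact.out : p.Prime).ne_zero
    have hsum : (∑ i, (c i : K) * w i) / p = ∑ j, (q j : K) * (B j : K) := by
      rw [div_eq_iff hp0]
      calc ∑ i, (c i : K) * w i = ∑ j, ((∑ i, c i * M i j : ℤ) : K) * (B j : K) := by
            simp_rw [hM, Finset.mul_sum]
            rw [Finset.sum_comm]
            simp_rw [Int.cast_sum, Finset.sum_mul]
            simp [mul_assoc]
        _ = (∑ j, (q j : K) * (B j : K)) * p := by
            rw [Finset.sum_mul]
            refine Finset.sum_congr rfl fun j _ => ?_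
            rw [hq j]
            push_cast
            ring
    have hint : IsIntegral ℤ ((∑ i, (c i : K) * w i) / p) := by
      rw [hsum]
      exact IsIntegral.sum _ fun j _ =>
        (isIntegral_algebraMap (R := ℤ) (x := q j)).mul (B j).isIntegral_coe
    refine hv0 (funext fun i => ?_)
    rw [← hc i]
    simpa using (ZMod.intCast_zmod_eq_zero_iff_dvd (c i) p).2 (hmax c hint i)
  · have hw' : w = ((M.map (Int.castRingHom ℚ)).map (algebraMap ℚ K)).mulVec
        (fun j => (B j : K)) := by
      ext i
      rw [hM]
      simp [Matrix.mulVec, dotProduct]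
    have hB : Algebra.discr ℚ (fun j => (B j : K)) = NumberField.discr K := by
      rw [NumberField.coe_discr, ← Algebra.discr_reindex ℚ (NumberField.integralBasis K) e]
      congr 1
      ext i
      simp [B]
    rw [hw', Algebra.discr_of_matrix_mulVec, hB, ← RingHom.mapMatrix_apply, ← RingHom.map_det]
    simp

/-! ### Integrality tests from conjugates -/

theorem isIntegral_of_eq {R : Type*} [CommRing R] {x y : R} (h : IsIntegral ℤ x) (e : y = x) :
    IsIntegral ℤ y := e ▸ h

theorem pow_three_of_cubeRoot {ω : ℂ} (hω : ω ^ 2 + ω + 1 = 0) : ω ^ 3 = 1 := by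
  linear_combination (ω - 1) * hω

theorem isIntegral_of_cubeRoot {ω : ℂ} (hω : ω ^ 2 + ω + 1 = 0) : IsIntegral ℤ ω :=
  isIntegral_of_pow_eq_intCast (n := 3) (m := 1) (by norm_num) (by simp [pow_three_of_cubeRoot hω])

theorem mul_cubeRoot_pow_six {b s ω : ℂ} (hs : s ^ 6 = -b) (hω : ω ^ 2 + ω + 1 = 0) :
    (ω * s) ^ 6 = -b := by
  rw [mul_pow, hs, show ω ^ 6 = (ω ^ 3) ^ 2 by ring, pow_three_of_cubeRoot hω]
  ring

namespace IsPureSextic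

variable {K : Type*} [Field K] [NumberField K] {θ : K} {b : ℤ}

theorem isIntegral_eval (h : IsPureSextic θ b) {a₀ a₁ a₂ a₃ a₄ a₅ : ℚ}
    (ha : IsIntegral ℤ ((a₀ : K) + a₁ * θ + a₂ * θ ^ 2 + a₃ * θ ^ 3 + a₄ * θ ^ 4 + a₅ * θ ^ 5))
    {s : ℂ} (hs : s ^ 6 = -(b : ℂ)) :
    IsIntegral ℤ ((a₀ : ℂ) + a₁ * s + a₂ * s ^ 2 + a₃ * s ^ 3 + a₄ * s ^ 4 + a₅ * s ^ 5) := by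
  have := h.isIntegral_sum_pow (a := ![a₀, a₁, a₂, a₃, a₄, a₅])
    (by simpa [Fin.sum_univ_six] using ha) hs
  simpa [Fin.sum_univ_six] using this

variable {a₀ a₁ a₂ a₃ a₄ a₅ : ℚ}

/-- Projection to the isotypic parts under `s ↦ ω * s`. -/
theorem isIntegral_thirds (h : IsPureSextic θ b)
    (ha : IsIntegral ℤ ((a₀ : K) + a₁ * θ + a₂ * θ ^ 2 + a₃ * θ ^ 3 + a₄ * θ ^ 4 + a₅ * θ ^ 5))
    {s : ℂ} (hs : s ^ 6 = -(b : ℂ)) :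
    IsIntegral ℤ (3 * ((a₀ : ℂ) + a₃ * s ^ 3) * s ^ 0) ∧
    IsIntegral ℤ (3 * ((a₁ : ℂ) + a₄ * s ^ 3) * s ^ 1) ∧
    IsIntegral ℤ (3 * ((a₂ : ℂ) + a₅ * s ^ 3) * s ^ 2) := by
  obtain ⟨ω, hω⟩ := exists_cubeRoot_one
  have iω := isIntegral_of_cubeRoot hω
  have hs' := mul_cubeRoot_pow_six hs hω
  have f0 := h.isIntegral_eval ha hs
  have f1 := h.isIntegral_eval ha hs'
  have f2 := h.isIntegral_eval ha (mul_cubeRoot_pow_six hs' hω)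
  refine ⟨?_, ?_, ?_⟩
  · refine isIntegral_of_eq ((f0.add f1).add f2) ?_
    grind
  · refine isIntegral_of_eq ((f0.add ((iω.pow 2).mul f1)).add (iω.mul f2)) ?_
    grind
  · refine isIntegral_of_eq ((f0.add (iω.mul f1)).add ((iω.pow 2).mul f2)) ?_
    grind

/-- Projection to the even and the odd part. -/
theorem isIntegral_halves (h : IsPureSextic θ b)
    (ha : IsIntegral ℤ ((a₀ : K) + a₁ * θ + a₂ * θ ^ 2 + a₃ * θ ^ 3 + a₄ * θ ^ 4 + a₅ * θ ^ 5))
    {s : ℂ} (hs : s ^ 6 = -(b : ℂ)) :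
    IsIntegral ℤ (2 * ((a₀ : ℂ) + a₂ * s ^ 2 + a₄ * s ^ 4)) ∧
    IsIntegral ℤ (2 * ((a₁ : ℂ) + a₃ * s ^ 2 + a₅ * s ^ 4) * s) := by
  have f0 := h.isIntegral_eval ha hs
  have f1 := h.isIntegral_eval ha (s := -s) (by rw [← hs]; ring)
  refine ⟨?_, ?_⟩
  · refine isIntegral_of_eq (f0.add f1) ?_
    ring
  · refine isIntegral_of_eq (f0.sub f1) ?_
    ring

/-- The integers obtained from the components `(x + y * θ ^ 3) * θ ^ i`, `x * θ ^ i` and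
`y * θ ^ (i + 3)` by taking norms. -/
theorem exists_intCast_of_third {x y : ℚ} {i : ℕ}
    (H : ∀ s : ℂ, s ^ 6 = -(b : ℂ) → IsIntegral ℤ (3 * ((x : ℂ) + y * s ^ 3) * s ^ i)) :
    (∃ n : ℤ, (n : ℚ) = 729 * (x ^ 2 + b * y ^ 2) ^ 3 * b ^ i) ∧
    (∃ n : ℤ, (n : ℚ) = (6 * x) ^ 6 * b ^ i) ∧ ∃ n : ℤ, (n : ℚ) = (6 * y) ^ 6 * b ^ (i + 3) := by
  obtain ⟨s, hs⟩ := exists_root b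
  have f0 := H s hs
  have f1 := ((isIntegral_one.neg : IsIntegral ℤ (-1 : ℂ)).pow i).mul
    (H (-s) (by rw [← hs]; ring))
  have e1 : (-1) ^ i * (3 * ((x : ℂ) + y * (-s) ^ 3) * (-s) ^ i) =
      3 * ((x : ℂ) - y * s ^ 3) * s ^ i := by
    have : ((-1) ^ i * (-s) ^ i : ℂ) = s ^ i := by rw [← mul_pow]; simp
    linear_combination 3 * ((x : ℂ) - y * s ^ 3) * this
  rw [e1] at f1
  have hn (j : ℕ) : (s ^ j) ^ 6 = (-1) ^ j * (b : ℂ) ^ j := by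
    rw [← pow_mul, mul_comm j, pow_mul, hs, neg_pow]
  have hneg (j : ℕ) : ((-1) ^ j * (-1) ^ j : ℂ) = 1 := by rw [← mul_pow]; simp
  have in1 (j : ℕ) : IsIntegral ℤ ((-1) ^ j : ℂ) := (isIntegral_one.neg).pow j
  refine ⟨?_, ?_, ?_⟩
  · apply Rat.exists_intCast_of_isIntegral (F := ℂ)
    refine isIntegral_of_eq ((in1 i).mul ((f0.mul f1).pow 3)) ?_
    push_cast
    have e : (s ^ i * s ^ i) ^ 3 = (-1) ^ i * (b : ℂ) ^ i := by rw [← hn]; ring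
    have e' : 3 * ((x : ℂ) + y * s ^ 3) * s ^ i * (3 * ((x : ℂ) - y * s ^ 3) * s ^ i) =
        9 * (x ^ 2 + b * y ^ 2) * (s ^ i * s ^ i) := by
      linear_combination (-9 * (y : ℂ) ^ 2 * s ^ i * s ^ i) * hs
    rw [e', mul_pow, e]
    linear_combination (-729 * ((x : ℂ) ^ 2 + b * y ^ 2) ^ 3 * b ^ i) * hneg i
  · apply Rat.exists_intCast_of_isIntegral (F := ℂ)
    refine isIntegral_of_eq ((in1 i).mul ((f0.add f1).pow 6)) ?_
    push_cast
    have e : 3 * ((x : ℂ) + y * s ^ 3) * s ^ i + 3 * ((x : ℂ) - y * s ^ 3) * s ^ i =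
        6 * x * s ^ i := by ring
    rw [e, mul_pow _ (s ^ i), hn]
    linear_combination (-(6 * (x : ℂ)) ^ 6 * b ^ i) * hneg i
  · apply Rat.exists_intCast_of_isIntegral (F := ℂ)
    refine isIntegral_of_eq ((in1 (i + 3)).mul ((f0.sub f1).pow 6)) ?_
    push_cast
    have e : 3 * ((x : ℂ) + y * s ^ 3) * s ^ i - 3 * ((x : ℂ) - y * s ^ 3) * s ^ i =
        6 * y * s ^ (i + 3) := by ring
    rw [e, mul_pow _ (s ^ (i + 3)), hn]
    linear_combination (-(6 * (y : ℂ)) ^ 6 * b ^ (i + 3)) * hneg (i + 3)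

/-- The three conjugates over `s, ω * s, ω ^ 2 * s` are those of an element of the pure cubic field
generated by `s ^ 2`. The integers are their second and third elementary symmetric functions. -/
theorem exists_intCast_of_even {x y z : ℚ}
    (H : ∀ s : ℂ, s ^ 6 = -(b : ℂ) → IsIntegral ℤ (2 * ((x : ℂ) + y * s ^ 2 + z * s ^ 4))) :
    (∃ n : ℤ, (n : ℚ) = 12 * (x ^ 2 + b * y * z)) ∧
    ∃ n : ℤ, (n : ℚ) = 8 * (x ^ 3 - b * y ^ 3 + b ^ 2 * z ^ 3 + 3 * b * x * y * z) := by
  obtain ⟨s, hs⟩ := exists_root b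
  obtain ⟨ω, hω⟩ := exists_cubeRoot_one
  have hs' := mul_cubeRoot_pow_six hs hω
  have f0 := H s hs
  have f1 := H _ hs'
  have f2 := H _ (mul_cubeRoot_pow_six hs' hω)
  refine ⟨?_, ?_⟩
  · apply Rat.exists_intCast_of_isIntegral (F := ℂ)
    refine isIntegral_of_eq (((f0.mul f1).add (f0.mul f2)).add (f1.mul f2)) ?_
    push_cast
    grind
  · apply Rat.exists_intCast_of_isIntegral (F := ℂ)
    refine isIntegral_of_eq ((f0.mul f1).mul f2) ?_
    push_cast
    grind

/-- The product of the three conjugates is the cubic norm times `s ^ 3`; only its square is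
rational, whence the extra factor `b`. -/
theorem exists_intCast_of_odd {x y z : ℚ}
    (H : ∀ s : ℂ, s ^ 6 = -(b : ℂ) → IsIntegral ℤ (2 * ((x : ℂ) + y * s ^ 2 + z * s ^ 4) * s)) :
    ∃ n : ℤ, (n : ℚ) = (8 * (x ^ 3 - b * y ^ 3 + b ^ 2 * z ^ 3 + 3 * b * x * y * z)) ^ 2 * b := by
  obtain ⟨s, hs⟩ := exists_root b
  obtain ⟨ω, hω⟩ := exists_cubeRoot_one
  have hs' := mul_cubeRoot_pow_six hs hω
  have f0 := H s hs
  have f1 := H _ hs'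
  have f2 := H _ (mul_cubeRoot_pow_six hs' hω)
  apply Rat.exists_intCast_of_isIntegral (F := ℂ)
  refine isIntegral_of_eq ((((f0.mul f1).mul f2).pow 2).neg) ?_
  have : 2 * ((x : ℂ) + y * s ^ 2 + z * s ^ 4) * s *
      (2 * ((x : ℂ) + y * (ω * s) ^ 2 + z * (ω * s) ^ 4) * (ω * s)) *
      (2 * ((x : ℂ) + y * (ω * (ω * s)) ^ 2 + z * (ω * (ω * s)) ^ 4) * (ω * (ω * s))) =
      8 * (x ^ 3 - b * y ^ 3 + b ^ 2 * z ^ 3 + 3 * b * x * y * z) * s ^ 3 := by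
    grind
  rw [this]
  push_cast
  grind

end IsPureSextic

/-! ### Local integral bases and the primes `p ≥ 5` -/

/-- By transitivity of integrality the coefficients may be any integral elements, not only integers.
This is used with coefficients involving `θ`. -/
theorem isIntegral_of_cubic {R : Type*} [CommRing R] {x e₁ e₂ e₃ : R} (h₁ : IsIntegral ℤ e₁)
    (h₂ : IsIntegral ℤ e₂) (h₃ : IsIntegral ℤ e₃) (h : x ^ 3 = e₁ * x ^ 2 + e₂ * x + e₃) :
    IsIntegral ℤ x := by
  let A := integralClosure ℤ R
  have : IsIntegral A x := by
    refine ⟨Polynomial.X ^ 3 - (Polynomial.C (⟨e₁, h₁⟩ : A) * Polynomial.X ^ 2 +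
      Polynomial.C (⟨e₂, h₂⟩ : A) * Polynomial.X + Polynomial.C (⟨e₃, h₃⟩ : A)), ?_, ?_⟩
    · refine Polynomial.monic_X_pow_sub (n := 3) ?_
      exact Polynomial.degree_quadratic_lt
    · simp only [Polynomial.eval₂_sub, Polynomial.eval₂_add, Polynomial.eval₂_mul,
        Polynomial.eval₂_pow, Polynomial.eval₂_X, Polynomial.eval₂_C]
      exact sub_eq_zero.2 h
  exact isIntegral_trans x this

theorem isIntegral_of_quadratic {R : Type*} [CommRing R] {x e₁ e₂ : R} (h₁ : IsIntegral ℤ e₁)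
    (h₂ : IsIntegral ℤ e₂) (h : x ^ 2 = e₁ * x + e₂) : IsIntegral ℤ x :=
  isIntegral_of_cubic h₁ h₂ isIntegral_zero (by linear_combination x * h)

namespace IsPureSextic

variable {K : Type*} [Field K] [NumberField K] {θ : K} {b : ℤ}

theorem exists_discr_of_matrix (h : IsPureSextic θ b) (p : ℕ) [Fact p.Prime] (k : ℕ)
    (P : Matrix (Fin 6) (Fin 6) ℚ) (hP : ∀ i j, i < j → P i j = 0)
    (hdiag : (∏ i, P i i) * p ^ k = 1)
    (hint : ∀ i, IsIntegral ℤ ((P i 0 : K) + P i 1 * θ + P i 2 * θ ^ 2 + P i 3 * θ ^ 3 +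
      P i 4 * θ ^ 4 + P i 5 * θ ^ 5))
    (hmax : ∀ (c : Fin 6 → ℤ) (a : Fin 6 → ℚ), (∀ j, a j = (∑ i, c i * P i j) / p) →
      IsIntegral ℤ ((a 0 : K) + a 1 * θ + a 2 * θ ^ 2 + a 3 * θ ^ 3 + a 4 * θ ^ 4 + a 5 * θ ^ 5) →
      ∀ i, (p : ℤ) ∣ c i) :
    ∃ d : ℤ, ¬ (p : ℤ) ∣ d ∧ -6 ^ 6 * b ^ 5 = (p : ℤ) ^ (2 * k) * (d ^ 2 * NumberField.discr K) := by
  let w : Fin 6 → K := fun i => ∑ j, (P i j : K) * θ ^ (j : ℕ)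
  obtain ⟨d, hd, hdisc⟩ := exists_discr_eq_sq_mul_discr (K := K) (p := p)
    (by rw [h.finrank_eq, Fintype.card_fin]) w
    (fun i => isIntegral_of_eq (hint i) (by simp [w, Fin.sum_univ_six])) (by
      intro c hc
      refine hmax c _ (fun j => rfl) (isIntegral_of_eq hc ?_)
      simp only [w, Fin.sum_univ_six]
      push_cast
      simp
      ring)
  refine ⟨d, hd, ?_⟩
  have hw : w = (P.map (algebraMap ℚ K)).mulVec (fun j => θ ^ (j : ℕ)) := by
    ext i
    simp [w, Matrix.mulVec, dotProduct]
  have hdet : P.det = ∏ i, P i i := Matrix.det_of_isLowerTriangular P fun i j hij => hP i j hij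
  rw [hw, Algebra.discr_of_matrix_mulVec, h.discr_pow, hdet] at hdisc
  have : ((-6 ^ 6 * b ^ 5 : ℤ) : ℚ) =
      ((p : ℤ) ^ (2 * k) * (d ^ 2 * NumberField.discr K) : ℤ) := by
    push_cast
    rw [← hdisc, pow_mul']
    linear_combination (-((∏ i, P i i) * p ^ k + 1) * (-6 ^ 6 * (b : ℚ) ^ 5)) * hdiag
  exact_mod_cast this

theorem isIntegral_monomial (h : IsPureSextic θ b) {q u : ℤ} {v i k : ℕ} (hq : q ≠ 0)
    (hb : b = q ^ v * u) (hk : 6 * k ≤ i * v) : IsIntegral ℤ (θ ^ i / (q : K) ^ k) := by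
  obtain ⟨r, hr⟩ := Nat.exists_eq_add_of_le hk
  refine isIntegral_of_pow_eq_intCast (n := 6) (m := (-u) ^ i * q ^ r) (by norm_num) ?_
  have hq' : (q : K) ≠ 0 := by exact_mod_cast hq
  rw [div_pow, div_eq_iff (by positivity), ← pow_mul, mul_comm i, pow_mul, h.pow_eq, hb]
  push_cast
  rw [← pow_mul, mul_assoc, ← pow_add, mul_comm k, add_comm r, ← hr, mul_comm i, pow_mul,
    ← mul_pow]
  ring

/-- The case of a local basis of the form `θ ^ i / p ^ k i`. -/
theorem exists_discr_of_monomial (h : IsPureSextic θ b) (p : ℕ) [hp : Fact p.Prime] {v : ℕ} {u : ℤ}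
    (hb : b = (p : ℤ) ^ v * u) (k : Fin 6 → ℕ) (hk : ∀ i : Fin 6, 6 * k i ≤ i * v)
    (hmax : ∀ (c : Fin 6 → ℤ) (a : Fin 6 → ℚ), (∀ j, a j = c j / p ^ (k j + 1)) →
      IsIntegral ℤ ((a 0 : K) + a 1 * θ + a 2 * θ ^ 2 + a 3 * θ ^ 3 + a 4 * θ ^ 4 + a 5 * θ ^ 5) →
      ∀ i, (p : ℤ) ∣ c i) :
    ∃ d : ℤ, ¬ (p : ℤ) ∣ d ∧
      -6 ^ 6 * b ^ 5 = (p : ℤ) ^ (2 * ∑ i, k i) * (d ^ 2 * NumberField.discr K) := by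
  have hp0 : (p : ℤ) ≠ 0 := by exact_mod_cast hp.out.ne_zero
  have hp0' : (p : ℚ) ≠ 0 := by exact_mod_cast hp.out.ne_zero
  refine h.exists_discr_of_matrix p (∑ i, k i) (Matrix.diagonal fun i => 1 / (p : ℚ) ^ k i) ?_ ?_
    ?_ ?_
  · intro i j hij
    exact Matrix.diagonal_apply_ne _ hij.ne
  · simp only [Matrix.diagonal_apply_eq]
    rw [← Finset.prod_pow_eq_pow_sum, ← Finset.prod_mul_distrib]
    exact Finset.prod_eq_one fun i _ => by field_simp
  · intro i
    refine isIntegral_of_eq (h.isIntegral_monomial hp0 hb (hk i)) ?_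
    fin_cases i <;> simp [Matrix.diagonal] <;> ring
  · intro c a ha
    refine hmax c a fun j => ?_
    rw [ha j]
    simp only [Matrix.diagonal_apply, mul_ite, mul_zero, Finset.sum_ite_eq', Finset.mem_univ,
      if_true]
    field_simp
    ring

theorem exists_intCast_coeff (h : IsPureSextic θ b) {a : Fin 6 → ℚ}
    (ha : IsIntegral ℤ ((a 0 : K) + a 1 * θ + a 2 * θ ^ 2 + a 3 * θ ^ 3 + a 4 * θ ^ 4 +
      a 5 * θ ^ 5)) (i : Fin 6) : ∃ n : ℤ, (n : ℚ) = (6 * a i) ^ 6 * b ^ (i : ℕ) := by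
  have H0 := exists_intCast_of_third fun s hs => (h.isIntegral_thirds ha hs).1
  have H1 := exists_intCast_of_third fun s hs => (h.isIntegral_thirds ha hs).2.1
  have H2 := exists_intCast_of_third fun s hs => (h.isIntegral_thirds ha hs).2.2
  fin_cases i
  exacts [H0.2.1, H1.2.1, H2.2.1, H0.2.2, H1.2.2, H2.2.2]

/-- At a prime `p ≥ 5` the monomials `θ ^ i / p ^ ⌊i * v / 6⌋` are a local integral basis. -/
theorem exists_discr_of_five_le (h : IsPureSextic θ b) (p : ℕ) [hp : Fact p.Prime] (hp5 : 5 ≤ p)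
    {v : ℕ} {u : ℤ} (hb : b = (p : ℤ) ^ v * u) (hu : ¬ (p : ℤ) ∣ u) :
    ∃ d : ℤ, ¬ (p : ℤ) ∣ d ∧
      -6 ^ 6 * b ^ 5 =
        (p : ℤ) ^ (2 * ∑ i : Fin 6, (i * v / 6 : ℕ)) * (d ^ 2 * NumberField.discr K) := by
  have hP : Prime (p : ℤ) := Nat.prime_iff_prime_int.1 hp.out
  have hp0' : (p : ℚ) ≠ 0 := by exact_mod_cast hp.out.ne_zero
  have h6 : ¬ (p : ℤ) ∣ 6 := by
    intro h6
    have : p ∣ 2 * 3 := by exact_mod_cast h6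
    rcases (Nat.Prime.dvd_mul hp.out).1 this with h | h
    · exact absurd (Nat.le_of_dvd (by norm_num) h) (by omega)
    · exact absurd (Nat.le_of_dvd (by norm_num) h) (by omega)
  refine h.exists_discr_of_monomial p hb (fun i => i * v / 6) (fun i => Nat.mul_div_le _ _) ?_
  intro c a ha hI i
  by_contra hc
  obtain ⟨n, hn⟩ := h.exists_intCast_coeff hI i
  have e : (6 * c i) ^ 6 * (u ^ (i : ℕ) * (p : ℤ) ^ (i * v)) =
      (p : ℤ) ^ (6 * (i * v / 6 + 1)) * n := by
    have : (((6 * c i) ^ 6 * (u ^ (i : ℕ) * (p : ℤ) ^ (i * v)) : ℤ) : ℚ) =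
        ((p : ℤ) ^ (6 * (i * v / 6 + 1)) * n : ℤ) := by
      push_cast
      rw [hn, ha i, hb]
      push_cast
      field_simp
      ring
    exact_mod_cast this
  -- The denominator `p ^ (i * v / 6 + 1)`, raised to the sixth power, exceeds the power `p ^ (i *
  -- v)` coming from `b ^ i`, so one factor `p` must divide the rest.
  have hlt : i * v + 1 ≤ 6 * (i * v / 6 + 1) := by omega
  have hd : (p : ℤ) ^ (i * v) * p ∣ (p : ℤ) ^ (i * v) * ((6 * c i) ^ 6 * u ^ (i : ℕ)) := by
    rw [← pow_succ]
    refine (pow_dvd_pow _ hlt).trans ⟨n, ?_⟩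
    rw [← e]
    ring
  have := (mul_dvd_mul_iff_left (pow_ne_zero _ hP.ne_zero)).1 hd
  rcases hP.dvd_or_dvd this with h1 | h1
  · rcases hP.dvd_or_dvd (hP.dvd_of_dvd_pow h1) with h2 | h2
    exacts [h6 h2, hc h2]
  · exact hu (hP.dvd_of_dvd_pow h1)

end IsPureSextic

/-! ### The prime 2 -/

theorem two_dvd_of_two_dvd_mul {u A : ℤ} {i : ℕ} (hu : Odd u) (h : 2 ∣ 729 * A ^ 3 * u ^ i) :
    2 ∣ A := by
  rw [← even_iff_two_dvd] at h ⊢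
  by_contra hA
  rw [Int.not_even_iff_odd] at hA
  exact Int.not_even_iff_odd.2 (((by decide : Odd (729 : ℤ)).mul (hA.pow)).mul hu.pow) h

/-- A cube divisible by `2 ^ 4` has a root of valuation at least 2. -/
theorem four_dvd_of_sixteen_dvd_mul {u A : ℤ} {i : ℕ} (hu : Odd u)
    (h : 16 ∣ 729 * A ^ 3 * u ^ i) : 4 ∣ A := by
  obtain ⟨B, rfl⟩ := two_dvd_of_two_dvd_mul hu ((by norm_num : (2 : ℤ) ∣ 16).trans h)
  have : 2 ∣ 729 * B ^ 3 * u ^ i := by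
    obtain ⟨n, hn⟩ := h
    exact ⟨n, by linarith⟩
  obtain ⟨C, rfl⟩ := two_dvd_of_two_dvd_mul hu this
  exact ⟨C, by ring⟩

theorem even_of_four_dvd_sq_add_two_mul {u X Y : ℤ} (hu : Odd u) (h : 4 ∣ X ^ 2 + 2 * u * Y ^ 2) :
    2 ∣ X ∧ 2 ∣ Y := by
  have hX : 2 ∣ X := Int.prime_two.dvd_of_dvd_pow (n := 2) (by
    have : X ^ 2 = X ^ 2 + 2 * u * Y ^ 2 - 2 * (u * Y ^ 2) := by ring
    rw [this]
    exact dvd_sub ((by norm_num : (2 : ℤ) ∣ 4).trans h) (dvd_mul_right _ _))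
  obtain ⟨X, rfl⟩ := hX
  refine ⟨dvd_mul_right _ _, ?_⟩
  have : 2 ∣ u * Y ^ 2 := by
    obtain ⟨n, hn⟩ := h
    exact ⟨n - X ^ 2, by linarith⟩
  rcases Int.prime_two.dvd_or_dvd this with h1 | h1
  · exact absurd (even_iff_two_dvd.2 h1) (Int.not_even_iff_odd.2 hu)
  · exact Int.prime_two.dvd_of_dvd_pow h1

/-- For `u ≡ 1` modulo 4 this is the anisotropy of `X ^ 2 + Y ^ 2` modulo 4; for `u ≡ 3` it fails,
and that is where `(1 + θ ^ 3) / 2` appears. -/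
theorem even_of_four_dvd_sq_add {u X Y : ℤ} (hu : u % 4 = 1) (h : 4 ∣ X ^ 2 + u * Y ^ 2) :
    2 ∣ X ∧ 2 ∣ Y := by
  obtain ⟨w, rfl⟩ : ∃ w, u = 4 * w + 1 := ⟨u / 4, by omega⟩
  rcases Int.even_or_odd' X with ⟨x, rfl | rfl⟩ <;> rcases Int.even_or_odd' Y with ⟨y, rfl | rfl⟩
  · simp
  all_goals
    ring_nf at h
    omega

theorem two_dvd_sub_of_two_dvd_sq_add {u X Y : ℤ} (hu : Odd u) (h : 2 ∣ X ^ 2 + u * Y ^ 2) :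
    2 ∣ X - Y := by
  rw [← even_iff_two_dvd] at h ⊢
  simpa [Int.even_add, Int.even_sub, Int.even_mul, Int.even_pow, Int.not_even_iff_odd.2 hu] using h

theorem two_dvd_of_two_dvd_mul_pow_six {u c : ℤ} {i : ℕ} (hu : Odd u) (h : 2 ∣ 729 * c ^ 6 * u ^ i) :
    2 ∣ c := by
  have : 2 ∣ 729 * (c ^ 2) ^ 3 * u ^ i := by rwa [← pow_mul]
  exact Int.prime_two.dvd_of_dvd_pow (two_dvd_of_two_dvd_mul hu this)

theorem forall_fin_six {P : Fin 6 → Prop} (h03 : P 0 ∧ P 3) (h14 : P 1 ∧ P 4) (h25 : P 2 ∧ P 5) :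
    ∀ i, P i := by
  intro i
  fin_cases i
  exacts [h03.1, h14.1, h25.1, h03.2, h14.2, h25.2]

namespace IsPureSextic

variable {K : Type*} [Field K] [NumberField K] {θ : K} {b u : ℤ} {a : Fin 6 → ℚ}

theorem exists_intCast_thirds (h : IsPureSextic θ b)
    (ha : IsIntegral ℤ ((a 0 : K) + a 1 * θ + a 2 * θ ^ 2 + a 3 * θ ^ 3 + a 4 * θ ^ 4 +
      a 5 * θ ^ 5)) :
    (∃ n : ℤ, (n : ℚ) = 729 * (a 0 ^ 2 + b * a 3 ^ 2) ^ 3 * b ^ 0) ∧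
    (∃ n : ℤ, (n : ℚ) = 729 * (a 1 ^ 2 + b * a 4 ^ 2) ^ 3 * b ^ 1) ∧
    ∃ n : ℤ, (n : ℚ) = 729 * (a 2 ^ 2 + b * a 5 ^ 2) ^ 3 * b ^ 2 :=
  ⟨(exists_intCast_of_third fun _ hs => (h.isIntegral_thirds ha hs).1).1,
    (exists_intCast_of_third fun _ hs => (h.isIntegral_thirds ha hs).2.1).1,
    (exists_intCast_of_third fun _ hs => (h.isIntegral_thirds ha hs).2.2).1⟩

theorem exists_discr_two_of_mod_four_eq_one (h : IsPureSextic θ b) (hb : b % 4 = 1) :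
    ∃ d : ℤ, ¬ 2 ∣ d ∧ -6 ^ 6 * b ^ 5 = d ^ 2 * NumberField.discr K := by
  have ho : Odd b := Int.odd_iff.2 (by omega)
  have key {i : ℕ} {x y : ℚ} {X Y n : ℤ} (hx : x = X / 2) (hy : y = Y / 2)
      (hn : (n : ℚ) = 729 * (x ^ 2 + b * y ^ 2) ^ 3 * b ^ i) : 2 ∣ X ∧ 2 ∣ Y := by
    refine even_of_four_dvd_sq_add hb (four_dvd_of_sixteen_dvd_mul (i := i) ho ⟨4 * n, ?_⟩)
    apply Int.cast_injective (α := ℚ)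
    push_cast
    rw [hn, hx, hy]
    ring
  have := h.exists_discr_of_monomial 2 (v := 0) (u := b) (by simp) (fun _ => 0) (by simp) (by
    intro c a ha hI
    obtain ⟨⟨n₀, h₀⟩, ⟨n₁, h₁⟩, ⟨n₂, h₂⟩⟩ := h.exists_intCast_thirds hI
    norm_num at ha
    exact forall_fin_six (key (ha 0) (ha 3) h₀) (key (ha 1) (ha 4) h₁) (key (ha 2) (ha 5) h₂))
  simpa using this

theorem exists_discr_two_of_eq_two_mul (h : IsPureSextic θ b) (hb : b = 2 * u) (hu : Odd u) :
    ∃ d : ℤ, ¬ 2 ∣ d ∧ -6 ^ 6 * b ^ 5 = d ^ 2 * NumberField.discr K := by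
  have key {i : ℕ} {x y : ℚ} {X Y n : ℤ} (hi : i ≤ 2) (hx : x = X / 2) (hy : y = Y / 2)
      (hn : (n : ℚ) = 729 * (x ^ 2 + b * y ^ 2) ^ 3 * b ^ i) : 2 ∣ X ∧ 2 ∣ Y := by
    -- The denominators contribute `2 ^ 6` and `b ^ i` absorbs `2 ^ i` with `i ≤ 2`, so a factor 16
    -- always survives.
    refine even_of_four_dvd_sq_add_two_mul hu
      (four_dvd_of_sixteen_dvd_mul (i := i) hu ⟨2 ^ (2 - i) * n, ?_⟩)
    apply Int.cast_injective (α := ℚ)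
    push_cast
    rw [hn, hx, hy, hb]
    interval_cases i <;> push_cast <;> ring
  have := h.exists_discr_of_monomial 2 (v := 1) (u := u) (by simpa using hb) (fun _ => 0)
    (by simp) (by
    intro c a ha hI
    obtain ⟨⟨n₀, h₀⟩, ⟨n₁, h₁⟩, ⟨n₂, h₂⟩⟩ := h.exists_intCast_thirds hI
    norm_num at ha
    exact forall_fin_six (key (by norm_num) (ha 0) (ha 3) h₀) (key (by norm_num) (ha 1) (ha 4) h₁)
      (key (by norm_num) (ha 2) (ha 5) h₂))
  simpa using this

theorem exists_discr_two_of_eq_eight_mul (h : IsPureSextic θ b) (hb : b = 8 * u) (hu : Odd u) :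
    ∃ d : ℤ, ¬ 2 ∣ d ∧ -6 ^ 6 * b ^ 5 = 2 ^ 12 * (d ^ 2 * NumberField.discr K) := by
  have key {X Y n : ℤ} (i : ℕ)
      (hn : (64 * n : ℚ) = 729 * (X ^ 2 + 2 * u * Y ^ 2) ^ 3 * u ^ i) : 2 ∣ X ∧ 2 ∣ Y := by
    refine even_of_four_dvd_sq_add_two_mul hu
      (four_dvd_of_sixteen_dvd_mul (i := i) hu ⟨4 * n, ?_⟩)
    apply Int.cast_injective (α := ℚ)
    push_cast
    linear_combination -hn
  have := h.exists_discr_of_monomial 2 (v := 3) (u := u) (by simpa using hb) ![0, 0, 1, 1, 2, 2]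
    (by decide) (by
    intro c a ha hI
    obtain ⟨⟨n₀, h₀⟩, ⟨n₁, h₁⟩, ⟨n₂, h₂⟩⟩ := h.exists_intCast_thirds hI
    have a0 : a 0 = c 0 / 2 := by simpa using ha 0
    have a1 : a 1 = c 1 / 2 := by simpa using ha 1
    have a2 : a 2 = c 2 / 4 := by simp [ha 2]; norm_num
    have a3 : a 3 = c 3 / 4 := by simp [ha 3]; norm_num
    have a4 : a 4 = c 4 / 8 := by simp [ha 4]; norm_num
    have a5 : a 5 = c 5 / 8 := by simp [ha 5]; norm_num
    rw [a0, a3, hb] at h₀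
    rw [a1, a4, hb] at h₁
    rw [a2, a5, hb] at h₂
    push_cast at h₀ h₁ h₂
    -- In this component `a 1 ^ 2 + b * a 4 ^ 2 = (2 * c 1 ^ 2 + u * c 4 ^ 2) / 8`. Multiplying by
    -- `u` brings it to the form required by `key`, with the two coordinates exchanged.
    obtain ⟨h4, h1⟩ := key (X := u * c 4) (Y := c 1) (n := n₁ * u ^ 2) 0 (by
      push_cast
      linear_combination 64 * (u : ℚ) ^ 2 * h₁)
    refine forall_fin_six (key 0 (n := n₀) ?_) ⟨h1, ?_⟩ (key 2 (n := n₂) ?_)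
    · linear_combination 64 * h₀
    · exact (Int.prime_two.dvd_or_dvd h4).resolve_left fun h =>
        Int.not_even_iff_odd.2 hu (even_iff_two_dvd.2 h)
    · linear_combination 64 * h₂)
  simpa [Fin.sum_univ_six] using this

/-- The elements `θ ^ i * (1 + θ ^ 3) / 2` are integral at `2`. -/
theorem exists_discr_two_of_mod_four_eq_three (h : IsPureSextic θ b) (hb : b % 4 = 3) :
    ∃ d : ℤ, ¬ 2 ∣ d ∧ -6 ^ 6 * b ^ 5 = 2 ^ 6 * (d ^ 2 * NumberField.discr K) := by
  have ho : Odd b := Int.odd_iff.2 (by omega)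
  have hθ : θ ^ 6 = -(b : K) := h.pow_eq
  obtain ⟨m, hm⟩ : ∃ m, b = 4 * m - 1 := ⟨(b + 1) / 4, by omega⟩
  have hhalf : IsIntegral ℤ ((1 + θ ^ 3) / 2) := by
    refine isIntegral_of_quadratic isIntegral_one (isIntegral_intCast (-m)) ?_
    rw [hm] at hθ
    push_cast at hθ ⊢
    linear_combination hθ / 4
  have key {i : ℕ} {x y : ℚ} {X Y n n' : ℤ} (hx : x = (X + Y / 2) / 2) (hy : y = Y / 4)
      (hn' : (n' : ℚ) = (6 * y) ^ 6 * b ^ (i + 3))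
      (hn : (n : ℚ) = 729 * (x ^ 2 + b * y ^ 2) ^ 3 * b ^ i) : 2 ∣ X ∧ 2 ∣ Y := by
    obtain ⟨Y, rfl⟩ : 2 ∣ Y := by
      refine two_dvd_of_two_dvd_mul_pow_six (i := i + 3) ho ⟨32 * n', ?_⟩
      apply Int.cast_injective (α := ℚ)
      push_cast
      rw [hn', hy]
      ring
    refine ⟨?_, dvd_mul_right _ _⟩
    -- With `Y` replaced by its half, the coordinates are `(X + Y) / 2` and `Y / 2`; their
    -- numerators have the same parity, so `X` is even.
    have := two_dvd_sub_of_two_dvd_sq_add (X := X + Y) (Y := Y) ho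
      (two_dvd_of_two_dvd_mul (i := i) ho ⟨32 * n, by
        apply Int.cast_injective (α := ℚ)
        push_cast
        rw [hn, hx, hy]
        push_cast
        ring⟩)
    simpa using this
  have hodd (i : ℕ) := (h.isIntegral.pow i).mul hhalf
  refine h.exists_discr_of_matrix 2 3
    !![1, 0, 0, 0, 0, 0; 0, 1, 0, 0, 0, 0; 0, 0, 1, 0, 0, 0; 1 / 2, 0, 0, 1 / 2, 0, 0;
      0, 1 / 2, 0, 0, 1 / 2, 0; 0, 0, 1 / 2, 0, 0, 1 / 2] ?_ ?_ ?_ ?_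
  · intro i j hij
    fin_cases i <;> fin_cases j <;> first | rfl | exact absurd hij (by decide)
  · simp [Fin.prod_univ_six]
    norm_num
  · intro i
    fin_cases i
    · exact isIntegral_of_eq isIntegral_one (by simp)
    · exact isIntegral_of_eq h.isIntegral (by simp)
    · exact isIntegral_of_eq (h.isIntegral.pow 2) (by simp)
    · exact isIntegral_of_eq (hodd 0) (by simp; ring)
    · exact isIntegral_of_eq (hodd 1) (by simp; ring)
    · exact isIntegral_of_eq (hodd 2) (by simp; ring)
  · intro c a ha hI
    obtain ⟨⟨n₀, h₀⟩, ⟨n₁, h₁⟩, ⟨n₂, h₂⟩⟩ := h.exists_intCast_thirds hI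
    have hc := h.exists_intCast_coeff hI
    obtain ⟨n₃, h₃⟩ := hc 3
    obtain ⟨n₄, h₄⟩ := hc 4
    obtain ⟨n₅, h₅⟩ := hc 5
    refine forall_fin_six (key ?_ ?_ h₃ h₀) (key ?_ ?_ h₄ h₁) (key ?_ ?_ h₅ h₂)
    all_goals
      rw [ha]
      simp [Fin.sum_univ_six]
      ring

/-- The elements `θ ^ i * (1 + θ ^ 3 / 2) / 2` are integral at `2`. -/
theorem exists_discr_two_of_eq_four_mul_mod_four_eq_three (h : IsPureSextic θ b) (hb : b = 4 * u)
    (hu : u % 4 = 3) :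
    ∃ d : ℤ, ¬ 2 ∣ d ∧ -6 ^ 6 * b ^ 5 = 2 ^ 12 * (d ^ 2 * NumberField.discr K) := by
  have ho : Odd u := Int.odd_iff.2 (by omega)
  have hθ : θ ^ 6 = -(b : K) := h.pow_eq
  obtain ⟨m, hm⟩ : ∃ m, u = 4 * m - 1 := ⟨(u + 1) / 4, by omega⟩
  have hhalf : IsIntegral ℤ ((1 + θ ^ 3 / 2) / 2) := by
    refine isIntegral_of_quadratic isIntegral_one (isIntegral_intCast (-m)) ?_
    rw [hb, hm] at hθ
    push_cast at hθ ⊢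
    linear_combination hθ / 16
  have key {i : ℕ} {x y : ℚ} {X Y n n' : ℤ} (hi : i ≤ 2) (hx : x = (X + Y / 2) / 2) (hy : y = Y / 8)
      (hn' : (n' : ℚ) = (6 * y) ^ 6 * b ^ (i + 3))
      (hn : (n : ℚ) = 729 * (x ^ 2 + b * y ^ 2) ^ 3 * b ^ i) : 2 ∣ X ∧ 2 ∣ Y := by
    obtain ⟨Y, rfl⟩ : 2 ∣ Y := by
      refine two_dvd_of_two_dvd_mul_pow_six (i := i + 3) ho ⟨2 * 4 ^ (2 - i) * n', ?_⟩
      apply Int.cast_injective (α := ℚ)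
      push_cast
      rw [hn', hy, hb]
      interval_cases i <;> push_cast <;> ring
    refine ⟨?_, dvd_mul_right _ _⟩
    have := two_dvd_sub_of_two_dvd_sq_add (X := X + Y) (Y := Y) ho
      (two_dvd_of_two_dvd_mul (i := i) ho ⟨2 * 4 ^ (2 - i) * n, by
        apply Int.cast_injective (α := ℚ)
        push_cast
        rw [hn, hx, hy, hb]
        interval_cases i <;> push_cast <;> ring⟩)
    simpa using this
  have hodd (i : ℕ) := (h.isIntegral.pow i).mul hhalf
  refine h.exists_discr_of_matrix 2 6
    !![1, 0, 0, 0, 0, 0; 0, 1, 0, 0, 0, 0; 0, 0, 1, 0, 0, 0; 1 / 2, 0, 0, 1 / 4, 0, 0;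
      0, 1 / 2, 0, 0, 1 / 4, 0; 0, 0, 1 / 2, 0, 0, 1 / 4] ?_ ?_ ?_ ?_
  · intro i j hij
    fin_cases i <;> fin_cases j <;> first | rfl | exact absurd hij (by decide)
  · simp [Fin.prod_univ_six]
    norm_num
  · intro i
    fin_cases i
    · exact isIntegral_of_eq isIntegral_one (by simp)
    · exact isIntegral_of_eq h.isIntegral (by simp)
    · exact isIntegral_of_eq (h.isIntegral.pow 2) (by simp)
    · exact isIntegral_of_eq (hodd 0) (by simp; ring)
    · exact isIntegral_of_eq (hodd 1) (by simp; ring)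
    · exact isIntegral_of_eq (hodd 2) (by simp; ring)
  · intro c a ha hI
    obtain ⟨⟨n₀, h₀⟩, ⟨n₁, h₁⟩, ⟨n₂, h₂⟩⟩ := h.exists_intCast_thirds hI
    have hc := h.exists_intCast_coeff hI
    obtain ⟨n₃, h₃⟩ := hc 3
    obtain ⟨n₄, h₄⟩ := hc 4
    obtain ⟨n₅, h₅⟩ := hc 5
    refine forall_fin_six (key (by norm_num) ?_ ?_ h₃ h₀) (key (by norm_num) ?_ ?_ h₄ h₁)
      (key (by norm_num) ?_ ?_ h₅ h₂)
    all_goals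
      rw [ha]
      simp [Fin.sum_univ_six]
      ring

/-- The element `θ ^ 2 * (1 + θ ^ 3 / 2) / 2` is integral at `2`. -/
theorem exists_discr_two_of_eq_four_mul_mod_four_eq_one (h : IsPureSextic θ b) (hb : b = 4 * u)
    (hu : u % 4 = 1) :
    ∃ d : ℤ, ¬ 2 ∣ d ∧ -6 ^ 6 * b ^ 5 = 2 ^ 8 * (d ^ 2 * NumberField.discr K) := by
  have ho : Odd u := Int.odd_iff.2 (by omega)
  have hθ : θ ^ 6 = -4 * (u : K) := by rw [h.pow_eq, hb]; push_cast; ring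
  obtain ⟨m, hm⟩ : ∃ m, u = 2 * m + 1 := ⟨u / 2, by omega⟩
  have hγ (i : ℕ) : IsIntegral ℤ (θ ^ i * (θ ^ 3 / 2)) :=
    (h.isIntegral.pow i).mul (isIntegral_of_pow_eq_intCast (n := 2) (m := -u) (by norm_num) (by
      push_cast
      linear_combination hθ / 4))
  have hhalf : IsIntegral ℤ (θ ^ 2 * (1 + θ ^ 3 / 2) / 2) := by
    -- With `δ = θ ^ 3 / 2` one has `δ ^ 2 = -u`, hence `(1 + δ) ^ 2 = 2 * (δ - m)`. As `θ ^ 6 = -4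
    -- * u`, the cube of the element is `-u * (1 + δ) * (δ - m)`.
    refine IsIntegral.of_pow (n := 3) (by norm_num) (isIntegral_of_eq
      ((isIntegral_intCast (-u)).mul ((isIntegral_one.add (hγ 0)).mul
        ((hγ 0).sub (isIntegral_intCast m)))) ?_)
    rw [hm] at hθ ⊢
    push_cast at hθ ⊢
    grind
  have key {i : ℕ} {x y : ℚ} {X Y n : ℤ} (hi : i ≤ 1) (hx : x = X / 2) (hy : y = Y / 4)
      (hn : (n : ℚ) = 729 * (x ^ 2 + b * y ^ 2) ^ 3 * b ^ i) : 2 ∣ X ∧ 2 ∣ Y := by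
    refine even_of_four_dvd_sq_add hu
      (four_dvd_of_sixteen_dvd_mul (i := i) ho ⟨4 ^ (1 - i) * n, ?_⟩)
    apply Int.cast_injective (α := ℚ)
    push_cast
    rw [hn, hx, hy, hb]
    interval_cases i <;> push_cast <;> ring
  refine h.exists_discr_of_matrix 2 4
    !![1, 0, 0, 0, 0, 0; 0, 1, 0, 0, 0, 0; 0, 0, 1, 0, 0, 0; 0, 0, 0, 1 / 2, 0, 0;
      0, 0, 0, 0, 1 / 2, 0; 0, 0, 1 / 2, 0, 0, 1 / 4] ?_ ?_ ?_ ?_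
  · intro i j hij
    fin_cases i <;> fin_cases j <;> first | rfl | exact absurd hij (by decide)
  · simp [Fin.prod_univ_six]
    norm_num
  · intro i
    fin_cases i
    · exact isIntegral_of_eq isIntegral_one (by simp)
    · exact isIntegral_of_eq h.isIntegral (by simp)
    · exact isIntegral_of_eq (h.isIntegral.pow 2) (by simp)
    · exact isIntegral_of_eq (hγ 0) (by simp; ring)
    · exact isIntegral_of_eq (hγ 1) (by simp; ring)
    · exact isIntegral_of_eq hhalf (by simp; ring)
  · intro c a ha hI
    obtain ⟨⟨n₀, h₀⟩, ⟨n₁, h₁⟩, ⟨n₂, h₂⟩⟩ := h.exists_intCast_thirds hI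
    obtain ⟨n₅, h₅ : (n₅ : ℚ) = (6 * a 5) ^ 6 * b ^ 5⟩ := h.exists_intCast_coeff hI 5
    refine forall_fin_six (key (by norm_num) ?_ ?_ h₀) (key (by norm_num) ?_ ?_ h₁) ?_
    rotate_right
    · have a2 : a 2 = (c 2 + c 5 / 2) / 2 := by
        rw [ha]
        simp [Fin.sum_univ_six]
        ring
      have a5 : a 5 = c 5 / 8 := by
        rw [ha]
        simp [Fin.sum_univ_six]
        ring
      obtain ⟨e, he⟩ : 2 ∣ c 5 := by
        refine two_dvd_of_two_dvd_mul_pow_six (i := 5) ho ⟨2 * n₅, ?_⟩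
        apply Int.cast_injective (α := ℚ)
        push_cast
        rw [h₅, a5, hb]
        push_cast
        ring
      refine ⟨?_, he ▸ dvd_mul_right _ _⟩
      have := two_dvd_sub_of_two_dvd_sq_add (X := c 2 + e) (Y := e) ho
        (two_dvd_of_two_dvd_mul (i := 2) ho ⟨2 * n₂, by
          apply Int.cast_injective (α := ℚ)
          push_cast
          rw [h₂, a2, a5, hb, he]
          push_cast
          ring⟩)
      simpa using this
    all_goals
      rw [ha]
      simp [Fin.sum_univ_six] <;> ring

end IsPureSextic

/-! ### The prime 3 -/

theorem three_dvd_of_dvd_sq_mul {u B : ℤ} (hu : ¬ 3 ∣ u) (h : 3 ∣ 64 * B ^ 2 * u) : 3 ∣ B := by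
  rcases Int.prime_three.dvd_or_dvd h with h | h
  · rcases Int.prime_three.dvd_or_dvd h with h | h
    · omega
    · exact Int.prime_three.dvd_of_dvd_pow h
  · exact absurd h hu

theorem nine_dvd_of_dvd_sq_mul {u B : ℤ} (hu : ¬ 3 ∣ u) (h : 27 ∣ 64 * B ^ 2 * u) : 9 ∣ B := by
  obtain ⟨B, rfl⟩ := three_dvd_of_dvd_sq_mul hu ((by norm_num : (3 : ℤ) ∣ 27).trans h)
  obtain ⟨n, hn⟩ := h
  obtain ⟨B, rfl⟩ := three_dvd_of_dvd_sq_mul (B := B) hu ⟨n, by linarith⟩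
  exact ⟨B, by ring⟩

theorem twentySeven_dvd_of_dvd_sq_mul {u B : ℤ} (hu : ¬ 3 ∣ u) (h : 243 ∣ 64 * B ^ 2 * u) :
    27 ∣ B := by
  obtain ⟨B, rfl⟩ := nine_dvd_of_dvd_sq_mul hu ((by norm_num : (27 : ℤ) ∣ 243).trans h)
  obtain ⟨n, hn⟩ := h
  obtain ⟨B, rfl⟩ := three_dvd_of_dvd_sq_mul (B := B) hu ⟨n, by linarith⟩
  exact ⟨B, by ring⟩

theorem three_dvd_of_dvd_mul_cube {u X : ℤ} (hu : ¬ 3 ∣ u) (h : 3 ∣ u * X ^ 3) : 3 ∣ X :=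
  Int.prime_three.dvd_of_dvd_pow ((Int.prime_three.dvd_or_dvd h).resolve_left hu)

/-- A cubic form whose terms have distinct valuations modulo three. -/
theorem three_dvd_of_eisenstein {e f g l X Y Z : ℤ} (he : ¬ 3 ∣ e) (hf : ¬ 3 ∣ f) (hg : ¬ 3 ∣ g)
    (h : 27 ∣ e * X ^ 3 + 3 * f * Y ^ 3 + 9 * g * Z ^ 3 + 9 * l * X * Y * Z) :
    3 ∣ X ∧ 3 ∣ Y ∧ 3 ∣ Z := by
  obtain ⟨n, hn⟩ := h
  obtain ⟨X, rfl⟩ := three_dvd_of_dvd_mul_cube (X := X) he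
    ⟨9 * n - f * Y ^ 3 - 3 * g * Z ^ 3 - 3 * l * X * Y * Z, by linarith⟩
  obtain ⟨Y, rfl⟩ := three_dvd_of_dvd_mul_cube (X := Y) hf
    ⟨3 * n - 3 * e * X ^ 3 - g * Z ^ 3 - 3 * l * X * Y * Z, by linarith⟩
  obtain ⟨Z, rfl⟩ := three_dvd_of_dvd_mul_cube (X := Z) hg
    ⟨n - e * X ^ 3 - 3 * f * Y ^ 3 - 3 * l * X * Y * Z, by linarith⟩
  exact ⟨dvd_mul_right _ _, dvd_mul_right _ _, dvd_mul_right _ _⟩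

theorem exists_sq_eq_of_not_three_dvd {u : ℤ} (hu : ¬ 3 ∣ u) : ∃ r, u ^ 2 = 1 + 3 * r := by
  obtain ⟨w, hw⟩ : ∃ w, u = 3 * w + 1 ∨ u = 3 * w - 1 := ⟨(u + 1) / 3, by omega⟩
  rcases hw with rfl | rfl
  exacts [⟨3 * w ^ 2 + 2 * w, by ring⟩, ⟨3 * w ^ 2 - 2 * w, by ring⟩]

theorem three_dvd_cube_sub (X : ℤ) : 3 ∣ X ^ 3 - X := by
  obtain ⟨w, hw⟩ : ∃ w, X = 3 * w ∨ X = 3 * w + 1 ∨ X = 3 * w - 1 := ⟨(X + 1) / 3, by omega⟩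
  rcases hw with rfl | rfl | rfl
  exacts [⟨9 * w ^ 3 - w, by ring⟩, ⟨9 * w ^ 3 + 9 * w ^ 2 + 2 * w, by ring⟩,
    ⟨9 * w ^ 3 - 9 * w ^ 2 + 2 * w, by ring⟩]

/-- The norm form of `ℤ[∛(-u)]` modulo `3`. -/
theorem three_dvd_of_dvd_norm {u X Y Z : ℤ}
    (h : 3 ∣ X ^ 3 - u * Y ^ 3 + u ^ 2 * Z ^ 3 + 3 * u * X * Y * Z) (hu : ¬ 3 ∣ u) :
    3 ∣ X - u * Y + Z := by
  obtain ⟨r, hr⟩ := exists_sq_eq_of_not_three_dvd hu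
  obtain ⟨n, hn⟩ := h
  obtain ⟨x, hx⟩ := three_dvd_cube_sub X
  obtain ⟨y, hy⟩ := three_dvd_cube_sub Y
  obtain ⟨z, hz⟩ := three_dvd_cube_sub Z
  exact ⟨n - u * X * Y * Z - x + u * y - z - r * Z ^ 3, by
    linear_combination hn - hx + u * hy - hz - Z ^ 3 * hr⟩

/-- The norm form of `ℤ[∛(-u)]` modulo `9`. -/
theorem three_dvd_of_nine_dvd_norm {u X Y Z : ℤ} (hu : ¬ 3 ∣ u) (hu9 : ¬ 9 ∣ u ^ 2 - 1)
    (h : 9 ∣ X ^ 3 - u * Y ^ 3 + u ^ 2 * Z ^ 3 + 3 * u * X * Y * Z) :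
    3 ∣ X - Z ∧ 3 ∣ Y + u * Z := by
  obtain ⟨t, ht⟩ := three_dvd_of_dvd_norm ((by norm_num : (3 : ℤ) ∣ 9).trans h) hu
  obtain ⟨r, hr⟩ := exists_sq_eq_of_not_three_dvd hu
  obtain ⟨n, hn⟩ := h
  obtain ⟨y, hy⟩ := three_dvd_cube_sub Y
  obtain ⟨z, hz⟩ := three_dvd_cube_sub Z
  have hX : X = u * Y - Z + 3 * t := by linarith
  -- At `X = u * Y - Z` the norm form equals `(u ^ 2 - 1) * (u * Y ^ 3 + Z ^ 3)`, and the correction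
  -- `3 * t` changes it only by multiples of 9.
  have h1 : 3 ∣ r * (u * Y ^ 3 + Z ^ 3) := by
    refine ⟨n - ((u * Y - Z) ^ 2 * t + 3 * (u * Y - Z) * t ^ 2 + 3 * t ^ 3 + u * t * Y * Z), ?_⟩
    have : 3 * (r * (u * Y ^ 3 + Z ^ 3)) = (u ^ 2 - 1) * (u * Y ^ 3 + Z ^ 3) := by
      linear_combination -(u * Y ^ 3 + Z ^ 3) * hr
    rw [hX] at hn
    have : 3 * (r * (u * Y ^ 3 + Z ^ 3)) = 3 * (3 * (n - ((u * Y - Z) ^ 2 * t +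
        3 * (u * Y - Z) * t ^ 2 + 3 * t ^ 3 + u * t * Y * Z))) := by
      rw [this]
      linear_combination hn
    linarith
  have hr3 : ¬ 3 ∣ r := fun ⟨s, hs⟩ => hu9 ⟨s, by linarith⟩
  obtain ⟨s, hs⟩ := (Int.prime_three.dvd_or_dvd h1).resolve_left hr3
  have h2 : 3 ∣ u * Y + Z := ⟨s - u * y - z, by linear_combination hs - u * hy - hz⟩
  obtain ⟨q, hq⟩ := h2
  have h3 : Y + u * Z = 3 * (u * q - r * Y) := by linear_combination u * hq - Y * hr
  refine ⟨?_, _, h3⟩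
  have h4 : X - Z = u * Y + Z - 3 * Z + 3 * t := by linarith
  exact ⟨q - Z + t, by rw [h4, hq]; ring⟩

/-- The norm form of `ℤ[∛(-u)]` modulo `27`. -/
theorem three_dvd_of_twentySeven_dvd_norm {u X Y Z : ℤ} (hu : ¬ 3 ∣ u)
    (h2 : 3 ∣ X ^ 2 + u * Y * Z)
    (h : 27 ∣ X ^ 3 - u * Y ^ 3 + u ^ 2 * Z ^ 3 + 3 * u * X * Y * Z) :
    3 ∣ X - Z ∧ 3 ∣ Y + u * Z ∧ (¬ 9 ∣ u ^ 2 - 1 → 3 ∣ Z) := by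
  obtain ⟨m, hm⟩ := three_dvd_of_dvd_norm ((by norm_num : (3 : ℤ) ∣ 27).trans h) hu
  obtain ⟨r, hr⟩ := exists_sq_eq_of_not_three_dvd hu
  have hY : 3 ∣ Y + u * Z := by
    obtain ⟨l, hl⟩ := h2
    have hX : X = u * Y - Z + 3 * m := by linarith
    -- Modulo 3, with `X ≡ u * Y - Z` and `u ^ 2 ≡ 1`, the form `X ^ 2 + u * Y * Z` becomes the
    -- square `(Y + u * Z) ^ 2`.
    refine Int.prime_three.dvd_of_dvd_pow (n := 2) ⟨l - r * Y ^ 2 + r * Z ^ 2 + u * Y * Z -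
      2 * m * (u * Y - Z) - 3 * m ^ 2, ?_⟩
    rw [hX] at hl
    linear_combination hl + (Z ^ 2 - Y ^ 2) * hr
  have hX : 3 ∣ X - Z := by
    obtain ⟨t, ht⟩ := hY
    exact ⟨m + u * t - Z - r * Z, by linear_combination hm + u * ht - Z * hr⟩
  refine ⟨hX, hY, fun h9 => ?_⟩
  obtain ⟨s, hs⟩ := hX
  obtain ⟨t, ht⟩ := hY
  obtain ⟨n, hn⟩ := h
  have hXs : X = Z + 3 * s := by linarith
  have hYt : Y = -u * Z + 3 * t := by linarith
  have hr3 : ¬ 3 ∣ r := fun ⟨s, hs⟩ => h9 ⟨s, by linarith⟩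
  -- At `X = Z`, `Y = -u * Z` the norm form is `(u ^ 2 - 1) ^ 2 * Z ^ 3 = 9 * r ^ 2 * Z ^ 3`; the
  -- terms in `s` and `t` are multiples of 27.
  have : 3 ∣ r ^ 2 * Z ^ 3 := by
    rw [hXs, hYt] at hn
    refine ⟨n - (s ^ 3 + Z * s ^ 2 - r * Z ^ 2 * s - u * r * Z ^ 2 * t + u ^ 2 * Z * t ^ 2 -
      u * t ^ 3 + u * s * t * Z), ?_⟩
    refine mul_left_cancel₀ (by norm_num : (9 : ℤ) ≠ 0) ?_
    linear_combination hn - (Z ^ 3 * (u ^ 2 - 1 + 3 * r) - 9 * Z ^ 2 * s - 9 * u * Z ^ 2 * t) * hr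
  exact three_dvd_of_dvd_mul_cube (fun h => hr3 (Int.prime_three.dvd_of_dvd_pow h)) this

namespace IsPureSextic

variable {K : Type*} [Field K] [NumberField K] {θ : K} {b u : ℤ} {a : Fin 6 → ℚ}

theorem exists_intCast_even (h : IsPureSextic θ b)
    (ha : IsIntegral ℤ ((a 0 : K) + a 1 * θ + a 2 * θ ^ 2 + a 3 * θ ^ 3 + a 4 * θ ^ 4 +
      a 5 * θ ^ 5)) :
    (∃ n : ℤ, (n : ℚ) = 12 * (a 0 ^ 2 + b * a 2 * a 4)) ∧ ∃ n : ℤ, (n : ℚ) =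
      8 * (a 0 ^ 3 - b * a 2 ^ 3 + b ^ 2 * a 4 ^ 3 + 3 * b * a 0 * a 2 * a 4) :=
  exists_intCast_of_even fun _ hs => (h.isIntegral_halves ha hs).1

theorem exists_intCast_odd (h : IsPureSextic θ b)
    (ha : IsIntegral ℤ ((a 0 : K) + a 1 * θ + a 2 * θ ^ 2 + a 3 * θ ^ 3 + a 4 * θ ^ 4 +
      a 5 * θ ^ 5)) :
    ∃ n : ℤ, (n : ℚ) =
      (8 * (a 1 ^ 3 - b * a 3 ^ 3 + b ^ 2 * a 5 ^ 3 + 3 * b * a 1 * a 3 * a 5)) ^ 2 * b :=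
  exists_intCast_of_odd fun _ hs => (h.isIntegral_halves ha hs).2

/-- Multiplication by `θ` turns the odd part into an even one. -/
theorem isIntegral_shift (h : IsPureSextic θ b)
    (ha : IsIntegral ℤ ((a 0 : K) + a 1 * θ + a 2 * θ ^ 2 + a 3 * θ ^ 3 + a 4 * θ ^ 4 +
      a 5 * θ ^ 5)) :
    IsIntegral ℤ (((-b * a 5 : ℚ) : K) + a 0 * θ + a 1 * θ ^ 2 + a 2 * θ ^ 3 + a 3 * θ ^ 4 +
      a 4 * θ ^ 5) := by
  refine isIntegral_of_eq (h.isIntegral.mul ha) ?_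
  push_cast
  linear_combination (-a 5 : K) * h.pow_eq

theorem exists_intCast_odd_shift (h : IsPureSextic θ b)
    (ha : IsIntegral ℤ ((a 0 : K) + a 1 * θ + a 2 * θ ^ 2 + a 3 * θ ^ 3 + a 4 * θ ^ 4 +
      a 5 * θ ^ 5)) :
    (∃ n : ℤ, (n : ℚ) = 12 * ((-b * a 5) ^ 2 + b * a 1 * a 3)) ∧ ∃ n : ℤ, (n : ℚ) =
      8 * ((-b * a 5) ^ 3 - b * a 1 ^ 3 + b ^ 2 * a 3 ^ 3 + 3 * b * (-b * a 5) * a 1 * a 3) :=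
  h.exists_intCast_even (a := ![-b * a 5, a 0, a 1, a 2, a 3, a 4])
    (by simpa using h.isIntegral_shift ha)

theorem three_dvd_of_cast_eq {x y z : ℚ} {X Y Z n₁ n₂ : ℤ} (hu : ¬ 3 ∣ u) (hx : x = X / 3)
    (hy : y = Y / 3) (hz : z = Z / 3) (h₁ : (n₁ : ℚ) = 12 * (x ^ 2 + u * y * z))
    (h₂ : (n₂ : ℚ) = 8 * (x ^ 3 - u * y ^ 3 + u ^ 2 * z ^ 3 + 3 * u * x * y * z)) :
    3 ∣ X - Z ∧ 3 ∣ Y + u * Z ∧ (¬ 9 ∣ u ^ 2 - 1 → 3 ∣ Z) := by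
  have e₁ : 4 * (X ^ 2 + u * Y * Z) = 3 * n₁ := by
    apply Int.cast_injective (α := ℚ)
    push_cast
    rw [h₁, hx, hy, hz]
    ring
  have e₂ : 8 * (X ^ 3 - u * Y ^ 3 + u ^ 2 * Z ^ 3 + 3 * u * X * Y * Z) = 27 * n₂ := by
    apply Int.cast_injective (α := ℚ)
    push_cast
    rw [h₂, hx, hy, hz]
    ring
  exact three_dvd_of_twentySeven_dvd_norm hu (by omega) (by omega)

/-- Since `θ` is a unit at 3, the odd part may be multiplied by `θ` without loss, and both parts are
tested by the same cubic norm form. -/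
theorem exists_discr_three_of_not_dvd (h : IsPureSextic θ b) (hb : ¬ 3 ∣ b)
    (hb9 : ¬ 9 ∣ b ^ 2 - 1) :
    ∃ d : ℤ, ¬ 3 ∣ d ∧ -6 ^ 6 * b ^ 5 = d ^ 2 * NumberField.discr K := by
  have key {x y z : ℚ} {X Y Z n₁ n₂ : ℤ} (hx : x = X / 3) (hy : y = Y / 3) (hz : z = Z / 3)
      (h₁ : (n₁ : ℚ) = 12 * (x ^ 2 + b * y * z))
      (h₂ : (n₂ : ℚ) = 8 * (x ^ 3 - b * y ^ 3 + b ^ 2 * z ^ 3 + 3 * b * x * y * z)) :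
      3 ∣ X ∧ 3 ∣ Y ∧ 3 ∣ Z := by
    obtain ⟨hX, hY, hZ⟩ := three_dvd_of_cast_eq hb hx hy hz h₁ h₂
    have hZ := hZ hb9
    exact ⟨(dvd_sub_left hZ).1 hX, (dvd_add_left (hZ.mul_left b)).1 hY, hZ⟩
  have := h.exists_discr_of_monomial 3 (v := 0) (u := b) (by simp) (fun _ => 0) (by simp) (by
    intro c a ha hI
    norm_num at ha
    obtain ⟨⟨n₁, h₁⟩, ⟨n₂, h₂⟩⟩ := h.exists_intCast_even hI
    obtain ⟨⟨n₃, h₃⟩, ⟨n₄, h₄⟩⟩ := h.exists_intCast_odd_shift hI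
    obtain ⟨hc0, hc2, hc4⟩ := key (ha 0) (ha 2) (ha 4) h₁ h₂
    obtain ⟨hc5, hc1, hc3⟩ := key (X := -b * c 5) (by rw [ha 5]; push_cast; ring) (ha 1) (ha 3)
      h₃ h₄
    replace hc5 : 3 ∣ c 5 := (Int.prime_three.dvd_or_dvd hc5).resolve_left (by rwa [dvd_neg])
    exact forall_fin_six ⟨hc0, hc3⟩ ⟨hc1, hc4⟩ ⟨hc2, hc5⟩)
  simpa using this

theorem exists_discr_three_of_eq_three_mul (h : IsPureSextic θ b) (hb : b = 3 * u)
    (hu : ¬ 3 ∣ u) :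
    ∃ d : ℤ, ¬ 3 ∣ d ∧ -6 ^ 6 * b ^ 5 = d ^ 2 * NumberField.discr K := by
  have hu2 : ¬ 3 ∣ u ^ 2 := fun h => hu (Int.prime_three.dvd_of_dvd_pow h)
  have := h.exists_discr_of_monomial 3 (v := 1) (u := u) (by simpa using hb) (fun _ => 0)
    (by simp) (by
    intro c a ha hI
    norm_num at ha
    obtain ⟨-, ⟨n₂, h₂⟩⟩ := h.exists_intCast_even hI
    obtain ⟨n₄, h₄⟩ := h.exists_intCast_odd hI
    obtain ⟨hc0, hc2, hc4⟩ := three_dvd_of_eisenstein (e := 1) (f := -u) (g := u ^ 2) (l := u)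
      (X := c 0) (Y := c 2) (Z := c 4) (by norm_num) (by simpa using hu) hu2 (by
        have : 8 * (1 * c 0 ^ 3 + 3 * -u * c 2 ^ 3 + 9 * u ^ 2 * c 4 ^ 3 +
            9 * u * c 0 * c 2 * c 4) = 27 * n₂ := by
          apply Int.cast_injective (α := ℚ)
          push_cast
          rw [h₂, ha, ha, ha, hb]
          push_cast
          ring
        omega)
    obtain ⟨hc1, hc3, hc5⟩ := three_dvd_of_eisenstein (e := 1) (f := -u) (g := u ^ 2) (l := u)
      (X := c 1) (Y := c 3) (Z := c 5) (by norm_num) (by simpa using hu) hu2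
      -- The squared denominator is `3 ^ 6` and `b` absorbs one factor 3, leaving `243 = 3 ^ 5`, an
      -- odd power that still forces `27` into the root.
      (twentySeven_dvd_of_dvd_sq_mul hu ⟨n₄, by
          apply Int.cast_injective (α := ℚ)
          push_cast
          rw [h₄, ha, ha, ha, hb]
          push_cast
          ring⟩)
    exact forall_fin_six ⟨hc0, hc3⟩ ⟨hc1, hc4⟩ ⟨hc2, hc5⟩)
  simpa using this

theorem exists_discr_three_of_eq_nine_mul (h : IsPureSextic θ b) (hb : b = 9 * u)
    (hu : ¬ 3 ∣ u) :
    ∃ d : ℤ, ¬ 3 ∣ d ∧ -6 ^ 6 * b ^ 5 = 3 ^ 6 * (d ^ 2 * NumberField.discr K) := by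
  have hu2 : ¬ 3 ∣ u ^ 2 := fun h => hu (Int.prime_three.dvd_of_dvd_pow h)
  have := h.exists_discr_of_monomial 3 (v := 2) (u := u) (by simpa using hb) ![0, 0, 0, 1, 1, 1]
    (by decide) (by
    intro c a ha hI
    have a0 : a 0 = c 0 / 3 := by simpa using ha 0
    have a1 : a 1 = c 1 / 3 := by simpa using ha 1
    have a2 : a 2 = c 2 / 3 := by simpa using ha 2
    have a3 : a 3 = c 3 / 9 := by simp [ha 3]; norm_num
    have a4 : a 4 = c 4 / 9 := by simp [ha 4]; norm_num
    have a5 : a 5 = c 5 / 9 := by simp [ha 5]; norm_num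
    obtain ⟨-, ⟨n₂, h₂⟩⟩ := h.exists_intCast_even hI
    obtain ⟨n₄, h₄⟩ := h.exists_intCast_odd hI
    -- The variables are listed by the valuation of their cubic terms: with `b = 9 * u` the `θ ^ 4`
    -- term precedes the `θ ^ 2` term, and in the odd part `θ ^ 3` comes first.
    obtain ⟨hc0, hc4, hc2⟩ := three_dvd_of_eisenstein (e := 1) (f := u ^ 2) (g := -u) (l := u)
      (X := c 0) (Y := c 4) (Z := c 2) (by norm_num) hu2 (by simpa using hu) (by
        have : 8 * (1 * c 0 ^ 3 + 3 * u ^ 2 * c 4 ^ 3 + 9 * -u * c 2 ^ 3 +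
            9 * u * c 0 * c 4 * c 2) = 27 * n₂ := by
          apply Int.cast_injective (α := ℚ)
          push_cast
          rw [h₂, a0, a2, a4, hb]
          push_cast
          ring
        omega)
    obtain ⟨hc3, hc1, hc5⟩ := three_dvd_of_eisenstein (e := -u) (f := 1) (g := u ^ 2) (l := u)
      (X := c 3) (Y := c 1) (Z := c 5) (by simpa using hu) (by norm_num) hu2
      (twentySeven_dvd_of_dvd_sq_mul hu ⟨3 * n₄, by
          apply Int.cast_injective (α := ℚ)
          push_cast
          rw [h₄, a1, a3, a5, hb]
          push_cast
          ring⟩)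
    exact forall_fin_six ⟨hc0, hc3⟩ ⟨hc1, hc4⟩ ⟨hc2, hc5⟩)
  simpa [Fin.sum_univ_six] using this

end IsPureSextic

theorem three_dvd_of_dvd_mul_pow_six {u c : ℤ} {i : ℕ} (hu : ¬ 3 ∣ u)
    (h : 3 ∣ 64 * c ^ 6 * u ^ i) : 3 ∣ c := by
  rcases Int.prime_three.dvd_or_dvd h with h | h
  · rcases Int.prime_three.dvd_or_dvd h with h | h
    · omega
    · exact Int.prime_three.dvd_of_dvd_pow h
  · exact absurd (Int.prime_three.dvd_of_dvd_pow h) hu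

namespace IsPureSextic

variable {K : Type*} [Field K] [NumberField K] {θ : K} {b u : ℤ} {a : Fin 6 → ℚ}

/-- This equation serves twice for `η = (1 - u * γ + γ ^ 2) / 3`. If `9 ∣ u ^ 2 - 1` then `3 ∣ r`
and `η` is integral. Otherwise, when `b = 27 * u`, scaling by `θ` turns the constant term into `r ^
2 * θ ^ 3 / 3`, and `θ * η` is integral. -/
theorem cube_third_eq {R : Type*} [Field R] [CharZero R] {γ u r : R} (hγ : γ ^ 3 = -u)
    (hr : u ^ 2 = 1 + 3 * r) :
    ((1 - u * γ + γ ^ 2) / 3) ^ 3 = ((1 - u * γ + γ ^ 2) / 3) ^ 2 +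
      r * ((1 - u * γ + γ ^ 2) / 3) + r ^ 2 / 3 := by
  obtain rfl : r = (u ^ 2 - 1) / 3 := by linear_combination -hr / 3
  obtain rfl : u = -γ ^ 3 := by linear_combination hγ
  ring

theorem isIntegral_third_of_sq_eq {R : Type*} [Field R] [CharZero R] {γ : R} (hγ : γ ^ 3 = -(u : R))
    {s : ℤ} (hs : u ^ 2 = 1 + 9 * s) : IsIntegral ℤ ((1 - u * γ + γ ^ 2) / 3) := by
  have hs' : (u : R) ^ 2 = 1 + 9 * s := by exact_mod_cast hs
  refine isIntegral_of_cubic isIntegral_one (isIntegral_intCast (3 * s))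
    (isIntegral_intCast (3 * s ^ 2)) ?_
  rw [cube_third_eq hγ (r := 3 * (s : R)) (by rw [hs']; ring)]
  push_cast
  ring

/-- Now `ℤ[θ]` is not maximal at 3: `η = (1 - b * θ ^ 2 + θ ^ 4) / 3` and `θ * η` enlarge it by
index `3 ^ 2`. -/
theorem exists_discr_three_of_nine_dvd (h : IsPureSextic θ b) (hb : 9 ∣ b ^ 2 - 1) :
    ∃ d : ℤ, ¬ 3 ∣ d ∧ -6 ^ 6 * b ^ 5 = 3 ^ 4 * (d ^ 2 * NumberField.discr K) := by
  obtain ⟨s, hs⟩ := hb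
  replace hs : b ^ 2 = 1 + 9 * s := by linarith
  have hb3 : ¬ 3 ∣ b := by
    rintro ⟨w, rfl⟩
    have : 9 * w ^ 2 = 1 + 9 * s := by linarith
    omega
  have hη : IsIntegral ℤ ((1 - b * θ ^ 2 + (θ ^ 2) ^ 2) / 3) :=
    isIntegral_third_of_sq_eq (by rw [← pow_mul, h.pow_eq]) hs
  refine h.exists_discr_of_matrix 3 2
    !![1, 0, 0, 0, 0, 0; 0, 1, 0, 0, 0, 0; 0, 0, 1, 0, 0, 0; 0, 0, 0, 1, 0, 0;
      1 / 3, 0, -b / 3, 0, 1 / 3, 0; 0, 1 / 3, 0, -b / 3, 0, 1 / 3] ?_ ?_ ?_ ?_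
  · intro i j hij
    fin_cases i <;> fin_cases j <;> first | rfl | exact absurd hij (by decide)
  · simp [Fin.prod_univ_six]
    norm_num
  · intro i
    fin_cases i
    · exact isIntegral_of_eq isIntegral_one (by simp)
    · exact isIntegral_of_eq h.isIntegral (by simp)
    · exact isIntegral_of_eq (h.isIntegral.pow 2) (by simp)
    · exact isIntegral_of_eq (h.isIntegral.pow 3) (by simp)
    · exact isIntegral_of_eq hη (by simp; ring)
    · exact isIntegral_of_eq (h.isIntegral.mul hη) (by simp; ring)
  · intro c a ha hI
    have a0 : a 0 = (c 0 + c 4 / 3) / 3 := by simp [ha, Fin.sum_univ_six]; ring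
    have a1 : a 1 = (c 1 + c 5 / 3) / 3 := by simp [ha, Fin.sum_univ_six]; ring
    have a2 : a 2 = (c 2 - b * (c 4 / 3)) / 3 := by simp [ha, Fin.sum_univ_six]; ring
    have a3 : a 3 = (c 3 - b * (c 5 / 3)) / 3 := by simp [ha, Fin.sum_univ_six]; ring
    have a4 : a 4 = c 4 / 9 := by simp [ha, Fin.sum_univ_six]; ring
    have a5 : a 5 = c 5 / 9 := by simp [ha, Fin.sum_univ_six]; ring
    obtain ⟨n₅, h₅ : (n₅ : ℚ) = (6 * a 4) ^ 6 * b ^ 4⟩ := h.exists_intCast_coeff hI 4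
    obtain ⟨n₆, h₆ : (n₆ : ℚ) = (6 * a 5) ^ 6 * b ^ 5⟩ := h.exists_intCast_coeff hI 5
    obtain ⟨e, he⟩ : 3 ∣ c 4 := three_dvd_of_dvd_mul_pow_six (i := 4) hb3 ⟨243 * n₅, by
      apply Int.cast_injective (α := ℚ)
      push_cast
      rw [h₅, a4]
      ring⟩
    obtain ⟨f, hf⟩ : 3 ∣ c 5 := three_dvd_of_dvd_mul_pow_six (i := 5) hb3 ⟨243 * n₆, by
      apply Int.cast_injective (α := ℚ)
      push_cast
      rw [h₆, a5]
      ring⟩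
    obtain ⟨⟨n₁, h₁⟩, ⟨n₂, h₂⟩⟩ := h.exists_intCast_even hI
    obtain ⟨⟨n₃, h₃⟩, ⟨n₄, h₄⟩⟩ := h.exists_intCast_odd_shift hI
    obtain ⟨hX, hY, -⟩ := three_dvd_of_cast_eq (X := c 0 + e) (Y := c 2 - b * e) (Z := e) hb3
      (by rw [a0, he]; push_cast; ring) (by rw [a2, he]; push_cast; ring)
      (by rw [a4, he]; push_cast; ring) h₁ h₂
    -- After multiplication by `θ` the odd part has coordinates `-b * a 5`, `a 1`, `a 3`.
    obtain ⟨hX', hY', -⟩ := three_dvd_of_cast_eq (X := -b * f) (Y := c 1 + f) (Z := c 3 - b * f) hb3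
      (by rw [a5, hf]; push_cast; ring) (by rw [a1, hf]; push_cast; ring)
      (by rw [a3, hf]; push_cast; ring) h₃ h₄
    have hc3 : 3 ∣ c 3 := by
      have : c 3 = -(-b * f - (c 3 - b * f)) := by ring
      rw [this]
      exact hX'.neg_right
    have hc1 : 3 ∣ c 1 := by
      have : c 1 = c 1 + f + b * (c 3 - b * f) + (3 * (3 * s) * f - b * c 3) := by
        linear_combination f * hs
      rw [this]
      exact hY'.add (dvd_sub (by rw [mul_assoc, mul_assoc]; exact dvd_mul_right _ _)
        (hc3.mul_left b))
    refine forall_fin_six ⟨by simpa using hX, hc3⟩ ⟨hc1, he ▸ dvd_mul_right _ _⟩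
      ⟨by simpa using hY, hf ▸ dvd_mul_right _ _⟩

/-- The case `b = 27 * u`, in terms of the cube root `γ = θ ^ 2 / 3` of `-u`. -/
theorem exists_discr_three_of_eq_mul_not_nine_dvd (h : IsPureSextic θ b) (hb : b = 27 * u)
    (hu : ¬ 3 ∣ u) (hu9 : ¬ 9 ∣ u ^ 2 - 1) :
    ∃ d : ℤ, ¬ 3 ∣ d ∧ -6 ^ 6 * b ^ 5 = 3 ^ 14 * (d ^ 2 * NumberField.discr K) := by
  have hθ : θ ^ 6 = -27 * (u : K) := by rw [h.pow_eq, hb]; push_cast; ring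
  have hγ : IsIntegral ℤ (θ ^ 2 / 3) :=
    isIntegral_of_pow_eq_intCast (n := 3) (m := -u) (by norm_num) (by
      push_cast
      linear_combination hθ / 27)
  have hδ : IsIntegral ℤ (θ ^ 3 / 3) :=
    isIntegral_of_pow_eq_intCast (n := 2) (m := -3 * u) (by norm_num) (by
      push_cast
      linear_combination hθ / 9)
  obtain ⟨r, hr⟩ := exists_sq_eq_of_not_three_dvd hu
  have hr' : (u : K) ^ 2 = 1 + 3 * r := by exact_mod_cast hr
  have hη : IsIntegral ℤ (θ * (1 - u * (θ ^ 2 / 3) + (θ ^ 2 / 3) ^ 2) / 3) := by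
    refine isIntegral_of_cubic h.isIntegral ((isIntegral_intCast r).mul (h.isIntegral.pow 2))
      (((isIntegral_intCast r).pow 2).mul hδ) ?_
    have := cube_third_eq (γ := θ ^ 2 / 3) (u := (u : K)) (by linear_combination hθ / 27) hr'
    linear_combination θ ^ 3 * this
  refine h.exists_discr_of_matrix 3 7
    !![1, 0, 0, 0, 0, 0; 0, 1, 0, 0, 0, 0; 0, 0, 1 / 3, 0, 0, 0; 0, 0, 0, 1 / 3, 0, 0;
      0, 0, 0, 0, 1 / 9, 0; 0, 1 / 3, 0, -u / 9, 0, 1 / 27] ?_ ?_ ?_ ?_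
  · intro i j hij
    fin_cases i <;> fin_cases j <;> first | rfl | exact absurd hij (by decide)
  · simp [Fin.prod_univ_six]
    norm_num
  · intro i
    fin_cases i
    · exact isIntegral_of_eq isIntegral_one (by simp)
    · exact isIntegral_of_eq h.isIntegral (by simp)
    · exact isIntegral_of_eq hγ (by simp; ring)
    · exact isIntegral_of_eq hδ (by simp; ring)
    · exact isIntegral_of_eq (hγ.pow 2) (by simp; ring)
    · exact isIntegral_of_eq hη (by simp; ring)
  · intro c a ha hI
    have a0 : a 0 = c 0 / 3 := by simp [ha, Fin.sum_univ_six]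
    have a1 : a 1 = (c 1 + c 5 / 3) / 3 := by simp [ha, Fin.sum_univ_six]; ring
    have a2 : 3 * a 2 = c 2 / 3 := by simp [ha, Fin.sum_univ_six]; ring
    have a3 : a 3 = (c 3 - u * (c 5 / 3)) / 9 := by simp [ha, Fin.sum_univ_six]; ring
    have a4 : 9 * a 4 = c 4 / 3 := by simp [ha, Fin.sum_univ_six]; ring
    have a5 : a 5 = c 5 / 81 := by simp [ha, Fin.sum_univ_six]; ring
    obtain ⟨n₆, h₆ : (n₆ : ℚ) = (6 * a 5) ^ 6 * b ^ 5⟩ := h.exists_intCast_coeff hI 5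
    obtain ⟨f, hf⟩ : 3 ∣ c 5 := three_dvd_of_dvd_mul_pow_six (i := 5) hu ⟨9 * n₆, by
      apply Int.cast_injective (α := ℚ)
      push_cast
      rw [h₆, a5, hb]
      push_cast
      ring⟩
    obtain ⟨⟨n₁, h₁⟩, ⟨n₂, h₂⟩⟩ := h.exists_intCast_even hI
    obtain ⟨n₄, h₄⟩ := h.exists_intCast_odd hI
    obtain ⟨hX, hY, hZ⟩ := three_dvd_of_cast_eq (x := a 0) (y := 3 * a 2) (z := 9 * a 4) hu a0 a2 a4
      (by rw [h₁, hb]; push_cast; ring) (by rw [h₂, hb]; push_cast; ring)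
    replace hZ := hZ hu9
    -- The factor `b = 27 * u` cancels half of the squared denominator `3 ^ 6`, so the norm form of
    -- the odd part is known only modulo 9.
    obtain ⟨hX', hY'⟩ := three_dvd_of_nine_dvd_norm (X := c 1 + f) (Y := c 3 - u * f) (Z := f)
      hu hu9 (nine_dvd_of_dvd_sq_mul hu ⟨n₄, by
        apply Int.cast_injective (α := ℚ)
        push_cast
        rw [h₄, a1, a3, a5, hf, hb]
        push_cast
        ring⟩)
    exact forall_fin_six ⟨(dvd_sub_left hZ).1 hX, by simpa using hY'⟩ ⟨by simpa using hX', hZ⟩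
      ⟨(dvd_add_left (hZ.mul_left u)).1 hY, hf ▸ dvd_mul_right _ _⟩

/-- With `γ = θ ^ 2 / 3`, the even part gains `η` as above, and the odd part gains `ρ = θ * (u + γ)
/ 3` and `τ = θ * (γ ^ 2 - 1) / 3`. -/
theorem exists_discr_three_of_eq_mul_nine_dvd (h : IsPureSextic θ b) (hb : b = 27 * u)
    (hu9 : 9 ∣ u ^ 2 - 1) :
    ∃ d : ℤ, ¬ 3 ∣ d ∧ -6 ^ 6 * b ^ 5 = 3 ^ 18 * (d ^ 2 * NumberField.discr K) := by
  obtain ⟨s, hs⟩ := hu9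
  replace hs : u ^ 2 = 1 + 9 * s := by linarith
  have hu : ¬ 3 ∣ u := by
    rintro ⟨w, rfl⟩
    have : 9 * w ^ 2 = 1 + 9 * s := by linarith
    omega
  have hs' : (u : K) ^ 2 = 1 + 9 * s := by exact_mod_cast hs
  have hθ : θ ^ 6 = -27 * (u : K) := by rw [h.pow_eq, hb]; push_cast; ring
  have hγ3 : (θ ^ 2 / 3) ^ 3 = -(u : K) := by linear_combination hθ / 27
  have hγ : IsIntegral ℤ (θ ^ 2 / 3) :=
    isIntegral_of_pow_eq_intCast (n := 3) (m := -u) (by norm_num) (by push_cast; exact hγ3)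
  have hη := isIntegral_third_of_sq_eq hγ3 hs
  have hρ : IsIntegral ℤ (θ * (u + θ ^ 2 / 3) / 3) := by
    refine isIntegral_of_cubic (e₁ := θ * (θ ^ 2 / 3)) (e₂ := u) (e₃ := u * s * (θ * (θ ^ 2 / 3)))
      (h.isIntegral.mul hγ) (isIntegral_intCast u)
      (((isIntegral_intCast u).mul (isIntegral_intCast s)).mul (h.isIntegral.mul hγ)) ?_
    -- Eliminating `u` and `s` in favour of `θ` makes the cubic equation of `ρ` a polynomial
    -- identity.
    have hu' : (u : K) = -(θ ^ 2 / 3) ^ 3 := by linear_combination hγ3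
    obtain h' : (s : K) = ((u : K) ^ 2 - 1) / 9 := by linear_combination -hs' / 9
    rw [h', hu']
    ring
  have hτ : IsIntegral ℤ (θ * ((θ ^ 2 / 3) ^ 2 - 1) / 3) := by
    -- Here `(γ - u) * ρ = θ * (γ ^ 2 - u ^ 2) / 3`, which differs from `τ` by `3 * s * θ`.
    refine isIntegral_of_eq (((hγ.sub (isIntegral_intCast u)).mul hρ).add
      (((isIntegral_intCast 3).mul (isIntegral_intCast s)).mul h.isIntegral)) ?_
    push_cast
    linear_combination θ / 3 * hs'
  refine h.exists_discr_of_matrix 3 9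
    !![1, 0, 0, 0, 0, 0; 0, 1, 0, 0, 0, 0; 0, 0, 1 / 3, 0, 0, 0; 0, u / 3, 0, 1 / 9, 0, 0;
      1 / 3, 0, -u / 9, 0, 1 / 27, 0; 0, -1 / 3, 0, 0, 0, 1 / 27] ?_ ?_ ?_ ?_
  · intro i j hij
    fin_cases i <;> fin_cases j <;> first | rfl | exact absurd hij (by decide)
  · simp [Fin.prod_univ_six]
    norm_num
  · intro i
    fin_cases i
    · exact isIntegral_of_eq isIntegral_one (by simp)
    · exact isIntegral_of_eq h.isIntegral (by simp)
    · exact isIntegral_of_eq hγ (by simp; ring)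
    · exact isIntegral_of_eq hρ (by simp; ring)
    · exact isIntegral_of_eq hη (by simp; ring)
    · exact isIntegral_of_eq hτ (by simp; ring)
  · intro c a ha hI
    have a0 : a 0 = (c 0 + c 4 / 3) / 3 := by simp [ha, Fin.sum_univ_six]; ring
    have a1 : a 1 = (c 1 + u * (c 3 / 3) - c 5 / 3) / 3 := by simp [ha, Fin.sum_univ_six]; ring
    have a2 : 3 * a 2 = (c 2 - u * (c 4 / 3)) / 3 := by simp [ha, Fin.sum_univ_six]; ring
    have a3 : a 3 = c 3 / 27 := by simp [ha, Fin.sum_univ_six]; ring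
    have a4 : 9 * a 4 = c 4 / 9 := by simp [ha, Fin.sum_univ_six]; ring
    have a5 : a 5 = c 5 / 81 := by simp [ha, Fin.sum_univ_six]; ring
    obtain ⟨n₃, h₃ : (n₃ : ℚ) = (6 * a 3) ^ 6 * b ^ 3⟩ := h.exists_intCast_coeff hI 3
    obtain ⟨n₅, h₅ : (n₅ : ℚ) = (6 * a 4) ^ 6 * b ^ 4⟩ := h.exists_intCast_coeff hI 4
    obtain ⟨n₆, h₆ : (n₆ : ℚ) = (6 * a 5) ^ 6 * b ^ 5⟩ := h.exists_intCast_coeff hI 5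
    obtain ⟨g, hg⟩ : 3 ∣ c 3 := three_dvd_of_dvd_mul_pow_six (i := 3) hu ⟨9 * n₃, by
      apply Int.cast_injective (α := ℚ)
      push_cast
      rw [h₃, a3, hb]
      push_cast
      ring⟩
    obtain ⟨e, he⟩ : 3 ∣ c 4 := three_dvd_of_dvd_mul_pow_six (i := 4) hu ⟨243 * n₅, by
      apply Int.cast_injective (α := ℚ)
      push_cast
      rw [h₅, show a 4 = c 4 / 81 by linarith, hb]
      push_cast
      ring⟩
    obtain ⟨f, hf⟩ : 3 ∣ c 5 := three_dvd_of_dvd_mul_pow_six (i := 5) hu ⟨9 * n₆, by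
      apply Int.cast_injective (α := ℚ)
      push_cast
      rw [h₆, a5, hb]
      push_cast
      ring⟩
    obtain ⟨⟨n₁, h₁⟩, ⟨n₂, h₂⟩⟩ := h.exists_intCast_even hI
    obtain ⟨n₄, h₄⟩ := h.exists_intCast_odd hI
    obtain ⟨hX, hY, -⟩ := three_dvd_of_cast_eq (x := a 0) (y := 3 * a 2) (z := 9 * a 4)
      (X := c 0 + e)
      (Y := c 2 - u * e) (Z := e) hu
      (by rw [a0, he]; push_cast; ring) (by rw [a2, he]; push_cast; ring)
      (by rw [a4, he]; push_cast; ring)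
      (by rw [h₁, hb]; push_cast; ring) (by rw [h₂, hb]; push_cast; ring)
    have hN : 9 ∣ (c 1 + u * g - f) ^ 3 - u * g ^ 3 + u ^ 2 * f ^ 3 +
        3 * u * (c 1 + u * g - f) * g * f := nine_dvd_of_dvd_sq_mul hu ⟨n₄, by
        apply Int.cast_injective (α := ℚ)
        push_cast
        rw [h₄, a1, a3, a5, hg, hf, hb]
        push_cast
        ring⟩
    -- Modulo 3 the norm form is the linear form `X - u * Y + Z`, which collapses to `c 1` in these
    -- coordinates.
    have hc1 := three_dvd_of_dvd_norm ((by norm_num : (3 : ℤ) ∣ 9).trans hN) hu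
    replace hc1 : 3 ∣ c 1 := by
      have : c 1 = c 1 + u * g - f - u * g + f := by ring
      rwa [this]
    exact forall_fin_six ⟨by simpa using hX, hg ▸ dvd_mul_right _ _⟩
      ⟨hc1, he ▸ dvd_mul_right _ _⟩ ⟨by simpa using hY, hf ▸ dvd_mul_right _ _⟩

end IsPureSextic

/-! ### Valuations and sign of the discriminant -/

theorem padicValInt_pow_mul {p : ℕ} [hp : Fact p.Prime] (n : ℕ) {u : ℤ} (hu : ¬ (p : ℤ) ∣ u) :
    padicValInt p ((p : ℤ) ^ n * u) = n := by
  have hu0 : u ≠ 0 := fun h => hu (h ▸ dvd_zero _)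
  have hp0 : (p : ℤ) ≠ 0 := by exact_mod_cast hp.out.ne_zero
  induction n with
  | zero => simpa using padicValInt.eq_zero_of_not_dvd hu
  | succ n ih =>
    rw [pow_succ, mul_right_comm, padicValInt_mul_eq_succ _ (mul_ne_zero (pow_ne_zero _ hp0) hu0),
      ih]

theorem eq_pow_mul_primeToPart (p : ℕ) [hp : Fact p.Prime] {b : ℤ} (hb : b ≠ 0) :
    b = (p : ℤ) ^ padicValInt p b * primeToPart p b ∧ ¬ (p : ℤ) ∣ primeToPart p b := by
  have h : b = (p : ℤ) ^ padicValInt p b * primeToPart p b :=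
    (Int.mul_ediv_cancel' (padicValInt_dvd b)).symm
  refine ⟨h, fun ⟨w, hw⟩ => ?_⟩
  have : (p : ℤ) ^ (padicValInt p b + 1) ∣ b := ⟨w, by rw [pow_succ, mul_assoc, ← hw, ← h]⟩
  have := ((padicValInt_dvd_iff _ _).1 this).resolve_left hb
  omega

theorem padicValInt_add_of_eq {p : ℕ} [hp : Fact p.Prime] {m k : ℕ} {s d D : ℤ}
    (hs : ¬ (p : ℤ) ∣ s) (hd : ¬ (p : ℤ) ∣ d) (hD : D ≠ 0)
    (h : (p : ℤ) ^ m * s = (p : ℤ) ^ (2 * k) * (d ^ 2 * D)) : padicValInt p D + 2 * k = m := by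
  have hP : Prime (p : ℤ) := Nat.prime_iff_prime_int.1 hp.out
  obtain ⟨hD', hndvd⟩ := eq_pow_mul_primeToPart p hD
  have h1 := padicValInt_pow_mul m hs
  have h2 : (p : ℤ) ^ m * s =
      (p : ℤ) ^ (padicValInt p D + 2 * k) * (d ^ 2 * primeToPart p D) := by
    rw [h, pow_add]
    nth_rw 1 [hD']
    ring
  rw [h2, padicValInt_pow_mul _ fun h => ?_] at h1
  · exact h1
  · rcases hP.dvd_or_dvd h with h | h
    exacts [hd (hP.dvd_of_dvd_pow h), hndvd h]

theorem padicValInt_lt_of_not_dvd {p n : ℕ} [Fact p.Prime] {b : ℤ} (h : ¬ (p : ℤ) ^ n ∣ b) :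
    padicValInt p b < n := by
  by_contra hn
  exact h ((padicValInt_dvd_iff _ _).2 (Or.inr (not_lt.1 hn)))

namespace IsPureSextic

variable {K : Type*} [Field K] [NumberField K] {θ : K} {b u : ℤ}

theorem ne_zero (h : IsPureSextic θ b) : b ≠ 0 := by
  rintro rfl
  have h0 : θ = 0 := by simpa using h.pow_eq
  have := h.natDegree_minpoly
  rw [h0, minpoly.zero, Polynomial.natDegree_X] at this
  omega

/-- `θ ^ 5 / q ^ k` generates the same field and exchanges the exponents `v` and `6 - v`. -/
theorem pow_five_div (h : IsPureSextic θ b) {q b' : ℤ} {k : ℕ} (hq : q ≠ 0)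
    (hb : b ^ 5 = q ^ (6 * k) * b') : IsPureSextic (θ ^ 5 / (q : K) ^ k) b' := by
  have hq' : (q : K) ≠ 0 := by exact_mod_cast hq
  have hb0 : (b : K) ≠ 0 := by exact_mod_cast h.ne_zero
  have hb' : (b : K) ^ 5 = q ^ (6 * k) * b' := by exact_mod_cast hb
  refine ⟨?_, ?_, h.finrank_eq⟩
  · rw [div_pow, div_eq_iff (by positivity), ← pow_mul, show 5 * 6 = 6 * 5 by norm_num, pow_mul,
      h.pow_eq, ← pow_mul, mul_comm k]
    linear_combination -hb'
  · rw [eq_top_iff, ← h.adjoin_eq, IntermediateField.adjoin_simple_le_iff]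
    -- Since `θ ^ 24 = b ^ 4`, the fifth power of the new generator is a rational multiple of `θ`.
    have hθ : θ = (θ ^ 5 / (q : K) ^ k) ^ 5 * ((q : K) ^ (5 * k) / (b : K) ^ 4) := by
      have : θ ^ 25 = θ * b ^ 4 := by
        linear_combination (θ * (θ ^ 18 - θ ^ 12 * b + θ ^ 6 * b ^ 2 - b ^ 3)) * h.pow_eq
      rw [div_pow, ← pow_mul, ← pow_mul, mul_comm k, div_mul_div_cancel₀ (by positivity), this]
      field_simp
    have hmem := IntermediateField.mem_adjoin_simple_self ℚ (θ ^ 5 / (q : K) ^ k)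
    have := mul_mem (pow_mem hmem 5) (div_mem (pow_mem (intCast_mem _ q) (5 * k))
      (pow_mem (intCast_mem _ b) 4))
    rwa [← hθ] at this

theorem padicValInt_discr_of_five_le (h : IsPureSextic θ b) (p : ℕ) [hp : Fact p.Prime]
    (hp5 : 5 ≤ p) (hb6 : ¬ (p : ℤ) ^ 6 ∣ b) :
    padicValInt p (NumberField.discr K) = 6 - Nat.gcd 6 (padicValInt p b) := by
  have hP : Prime (p : ℤ) := Nat.prime_iff_prime_int.1 hp.out
  have h6 : ¬ (p : ℤ) ∣ 6 := by
    intro h6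
    have : p ∣ 2 * 3 := by exact_mod_cast h6
    rcases (Nat.Prime.dvd_mul hp.out).1 this with h | h
    · exact absurd (Nat.le_of_dvd (by norm_num) h) (by omega)
    · exact absurd (Nat.le_of_dvd (by norm_num) h) (by omega)
  obtain ⟨hb, hu⟩ := eq_pow_mul_primeToPart p h.ne_zero
  have hv := padicValInt_lt_of_not_dvd hb6
  generalize padicValInt p b = v at hb hv ⊢
  generalize primeToPart p b = u at hb hu
  obtain ⟨d, hd, hdisc⟩ := h.exists_discr_of_five_le p hp5 hb hu
  have := padicValInt_add_of_eq (m := 5 * v) (s := -6 ^ 6 * u ^ 5) (fun h => by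
    rcases hP.dvd_or_dvd h with h | h
    · exact h6 (hP.dvd_of_dvd_pow (dvd_neg.1 h))
    · exact hu (hP.dvd_of_dvd_pow h)) hd (NumberField.discr_ne_zero K) (by
      rw [← hdisc, hb]
      ring)
  rw [Fin.sum_univ_six] at this
  interval_cases v <;> simp at this ⊢ <;> omega

theorem padicValInt_two_add_of_eq (v k : ℕ) {d : ℤ} (hu : Odd u) (hb : b = 2 ^ v * u)
    (hd : ¬ 2 ∣ d) (h : -6 ^ 6 * b ^ 5 = 2 ^ (2 * k) * (d ^ 2 * NumberField.discr K)) :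
    padicValInt 2 (NumberField.discr K) + 2 * k = 6 + 5 * v := by
  refine padicValInt_add_of_eq (s := -3 ^ 6 * u ^ 5) ?_ hd (NumberField.discr_ne_zero K) ?_
  · exact fun h => Int.not_even_iff_odd.2 (((by decide : Odd (-3 ^ 6 : ℤ)).mul hu.pow))
      (even_iff_two_dvd.2 h)
  · push_cast
    rw [← h, hb]
    ring

theorem padicValInt_three_add_of_eq (v k : ℕ) {d : ℤ} (hu : ¬ 3 ∣ u) (hb : b = 3 ^ v * u)
    (hd : ¬ 3 ∣ d) (h : -6 ^ 6 * b ^ 5 = 3 ^ (2 * k) * (d ^ 2 * NumberField.discr K)) :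
    padicValInt 3 (NumberField.discr K) + 2 * k = 6 + 5 * v := by
  refine padicValInt_add_of_eq (s := -2 ^ 6 * u ^ 5) ?_ hd (NumberField.discr_ne_zero K) ?_
  · intro h
    rcases Int.prime_three.dvd_or_dvd h with h | h
    · norm_num at h
    · exact hu (Int.prime_three.dvd_of_dvd_pow h)
  · push_cast
    rw [← h, hb]
    ring

theorem padicValInt_discr_two_of_eq_two_mul (h : IsPureSextic θ b) (hb : b = 2 * u)
    (hu : Odd u) : padicValInt 2 (NumberField.discr K) = 11 := by
  obtain ⟨d, hd, hdisc⟩ := h.exists_discr_two_of_eq_two_mul hb hu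
  have := padicValInt_two_add_of_eq 1 0 hu (by simpa using hb) hd (by simpa using hdisc)
  omega

theorem padicValInt_discr_two_of_eq_four_mul (h : IsPureSextic θ b) (hb : b = 4 * u)
    (hu : Odd u) :
    padicValInt 2 (NumberField.discr K) = if u % 4 = 3 then 4 else 8 := by
  have := Int.odd_iff.1 hu
  split_ifs with h4
  · obtain ⟨d, hd, hdisc⟩ := h.exists_discr_two_of_eq_four_mul_mod_four_eq_three hb h4
    have := padicValInt_two_add_of_eq 2 6 hu (by simpa using hb) hd hdisc
    omega
  · obtain ⟨d, hd, hdisc⟩ := h.exists_discr_two_of_eq_four_mul_mod_four_eq_one hb (by omega)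
    have := padicValInt_two_add_of_eq 2 4 hu (by simpa using hb) hd hdisc
    omega

theorem padicValInt_discr_two (h : IsPureSextic θ b) (hb6 : ¬ (2 : ℤ) ^ 6 ∣ b) :
    padicValInt 2 (NumberField.discr K) = expTwo b := by
  obtain ⟨hb, hu⟩ := eq_pow_mul_primeToPart 2 h.ne_zero
  have hv := padicValInt_lt_of_not_dvd hb6
  generalize hu' : primeToPart 2 b = u at hb hu
  generalize hv' : padicValInt 2 b = v at hb hv
  have ho : Odd u := by rwa [← Int.not_even_iff_odd, even_iff_two_dvd]
  have ho' := Int.odd_iff.1 ho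
  -- The passage from `v = 4` to `v = 2` replaces `u` by `u ^ 5`, which is congruent to `u` modulo
  -- 4.
  have hpow : (if u ^ 5 % 4 = 3 then 4 else 8) = if u % 4 = 3 then 4 else 8 := by
    rcases (by omega : u % 4 = 1 ∨ u % 4 = 3) with h4 | h4 <;> simp [pow_succ, Int.mul_emod, h4]
  simp only [expTwo, hu', hv', Int.ModEq]
  push_cast at hb
  interval_cases v
  · have hbu : b = u := by simpa using hb
    rcases (by omega : b % 4 = 1 ∨ b % 4 = 3) with h4 | h4
    · obtain ⟨d, hd, hdisc⟩ := h.exists_discr_two_of_mod_four_eq_one h4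
      have := padicValInt_two_add_of_eq 0 0 ho hb hd (by simpa using hdisc)
      rw [if_neg (by omega), if_pos (by omega)]
      omega
    · obtain ⟨d, hd, hdisc⟩ := h.exists_discr_two_of_mod_four_eq_three h4
      have := padicValInt_two_add_of_eq 0 3 ho hb hd hdisc
      rw [if_pos (by omega)]
      omega
  · rw [h.padicValInt_discr_two_of_eq_two_mul (by simpa using hb) ho, if_neg (by omega),
      if_neg (by omega), if_pos (by norm_num)]
  · rcases (by omega : u % 4 = 1 ∨ u % 4 = 3) with h4 | h4
    · rw [h.padicValInt_discr_two_of_eq_four_mul (by simpa using hb) ho, if_neg (by omega),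
        if_neg (by omega), if_neg (by omega)]
      simp [h4]
    · rw [h.padicValInt_discr_two_of_eq_four_mul (by simpa using hb) ho, if_pos h4,
        if_neg (by omega), if_neg (by omega)]
      simp [h4]
  · obtain ⟨d, hd, hdisc⟩ := h.exists_discr_two_of_eq_eight_mul (by simpa using hb) ho
    have := padicValInt_two_add_of_eq 3 6 ho hb hd hdisc
    rw [if_neg (by omega), if_neg (by omega)]
    simp
    omega
  · have h' := h.pow_five_div (q := 2) (b' := 4 * u ^ 5) (k := 3) (by norm_num)
      (by rw [hb]; ring)
    rcases (by omega : u % 4 = 1 ∨ u % 4 = 3) with h4 | h4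
    · rw [h'.padicValInt_discr_two_of_eq_four_mul rfl ho.pow, hpow, if_neg (by omega),
        if_neg (by omega), if_neg (by omega)]
      simp [h4]
    · rw [h'.padicValInt_discr_two_of_eq_four_mul rfl ho.pow, hpow, if_pos h4,
        if_neg (by omega), if_neg (by omega)]
      simp [h4]
  · have h' := h.pow_five_div (q := 2) (b' := 2 * u ^ 5) (k := 4) (by norm_num)
      (by rw [hb]; ring)
    rw [h'.padicValInt_discr_two_of_eq_two_mul rfl ho.pow, if_neg (by omega),
      if_neg (by omega), if_pos (by norm_num)]

theorem padicValInt_discr_three_of_eq_three_mul (h : IsPureSextic θ b) (hb : b = 3 * u)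
    (hu : ¬ 3 ∣ u) : padicValInt 3 (NumberField.discr K) = 11 := by
  obtain ⟨d, hd, hdisc⟩ := h.exists_discr_three_of_eq_three_mul hb hu
  have := padicValInt_three_add_of_eq 1 0 hu (by simpa using hb) hd (by simpa using hdisc)
  omega

theorem padicValInt_discr_three_of_eq_nine_mul (h : IsPureSextic θ b) (hb : b = 9 * u)
    (hu : ¬ 3 ∣ u) : padicValInt 3 (NumberField.discr K) = 10 := by
  obtain ⟨d, hd, hdisc⟩ := h.exists_discr_three_of_eq_nine_mul hb hu
  have := padicValInt_three_add_of_eq 2 3 hu (by simpa using hb) hd hdisc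
  omega

theorem padicValInt_discr_three (h : IsPureSextic θ b) (hb6 : ¬ (3 : ℤ) ^ 6 ∣ b) :
    padicValInt 3 (NumberField.discr K) = expThree b := by
  obtain ⟨hb, hu⟩ := eq_pow_mul_primeToPart 3 h.ne_zero
  have hv := padicValInt_lt_of_not_dvd hb6
  generalize hu' : primeToPart 3 b = u at hb hu
  generalize hv' : padicValInt 3 b = v at hb hv
  have hu5 : ¬ 3 ∣ u ^ 5 := fun h => hu (Int.prime_three.dvd_of_dvd_pow h)
  push_cast at hb hu
  simp only [expThree, hu', hv', Int.ModEq]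
  interval_cases v
  · have hbu : b = u := by simpa using hb
    have hsq : b ^ 2 % 9 = (b % 9) ^ 2 % 9 := by simp [pow_two, Int.mul_emod]
    by_cases h9 : b % 9 = 1 ∨ b % 9 = 8
    · obtain ⟨d, hd, hdisc⟩ := h.exists_discr_three_of_nine_dvd (by
        rcases h9 with h9 | h9 <;> norm_num [h9] at hsq <;> omega)
      have := padicValInt_three_add_of_eq 0 2 hu hb hd hdisc
      rw [if_pos (by omega)]
      omega
    · have h9' : b % 9 = 2 ∨ b % 9 = 4 ∨ b % 9 = 5 ∨ b % 9 = 7 := by omega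
      obtain ⟨d, hd, hdisc⟩ := h.exists_discr_three_of_not_dvd (hbu ▸ hu) (by
        rcases h9' with h9 | h9 | h9 | h9 <;> norm_num [h9] at hsq <;> omega)
      have := padicValInt_three_add_of_eq 0 0 hu hb hd (by simpa using hdisc)
      rw [if_neg (by omega), if_pos (by omega)]
      omega
  · rw [h.padicValInt_discr_three_of_eq_three_mul (by simpa using hb) hu, if_neg (by omega),
      if_neg (by omega), if_pos (by norm_num)]
  · rw [h.padicValInt_discr_three_of_eq_nine_mul (by simpa using hb) hu, if_neg (by omega),
      if_neg (by omega), if_neg (by norm_num), if_pos (by norm_num)]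
  · rw [if_neg (by omega), if_neg (by omega), if_neg (by norm_num), if_neg (by norm_num)]
    by_cases h9 : 9 ∣ u ^ 2 - 1
    · obtain ⟨d, hd, hdisc⟩ := h.exists_discr_three_of_eq_mul_nine_dvd (by simpa using hb) h9
      have := padicValInt_three_add_of_eq 3 9 hu hb hd hdisc
      rw [if_pos (by omega)]
      omega
    · obtain ⟨d, hd, hdisc⟩ := h.exists_discr_three_of_eq_mul_not_nine_dvd (by simpa using hb) hu h9
      have := padicValInt_three_add_of_eq 3 7 hu hb hd hdisc
      rw [if_neg (by omega), if_pos (by omega)]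
      omega
  · have h' := h.pow_five_div (q := 3) (b' := 9 * u ^ 5) (k := 3) (by norm_num)
      (by rw [hb]; ring)
    rw [h'.padicValInt_discr_three_of_eq_nine_mul rfl hu5, if_neg (by omega),
      if_neg (by omega), if_neg (by norm_num), if_pos (by norm_num)]
  · have h' := h.pow_five_div (q := 3) (b' := 3 * u ^ 5) (k := 4) (by norm_num)
      (by rw [hb]; ring)
    rw [h'.padicValInt_discr_three_of_eq_three_mul rfl hu5, if_neg (by omega),
      if_neg (by omega), if_pos (by norm_num)]

/-- Any relation `-6 ^ 6 * b ^ 5 = square * d_K` determines the sign. The prime 5 is an arbitrary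
choice: for `p ≥ 5` such a relation is available without case distinctions. -/
theorem sign_discr (h : IsPureSextic θ b) : (NumberField.discr K).sign = (-b).sign := by
  have hb := h.ne_zero
  have : Fact (Nat.Prime 5) := ⟨by norm_num⟩
  obtain ⟨v, u, hu, hbu⟩ : ∃ v : ℕ, ∃ u : ℤ, ¬ (5 : ℤ) ∣ u ∧ b = (5 : ℤ) ^ v * u :=
    ⟨_, _, (eq_pow_mul_primeToPart 5 hb).2, (eq_pow_mul_primeToPart 5 hb).1⟩
  obtain ⟨d, hd, hdisc⟩ := h.exists_discr_of_five_le 5 le_rfl hbu hu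
  have hd0 : d ≠ 0 := fun h => hd (h ▸ dvd_zero _)
  have h1 : ((6 ^ 6 * b ^ 4) * -b).sign = ((5 ^ (2 * ∑ i : Fin 6, (i * v / 6 : ℕ)) * d ^ 2) *
      NumberField.discr K).sign := by
    congr 1
    push_cast at hdisc
    linear_combination hdisc
  rwa [Int.sign_mul, Int.sign_eq_one_of_pos (a := 6 ^ 6 * b ^ 4) (by positivity), one_mul,
    Int.sign_mul, Int.sign_eq_one_of_pos (a := _ * d ^ 2) (by positivity), one_mul,
    eq_comm] at h1

end IsPureSextic

/-! ### Assembling the local exponents -/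

open Polynomial in
theorem isPureSextic_of_irreducible {K : Type*} [Field K] [NumberField K] {b : ℤ} {θ : K}
    (hirr : Irreducible (X ^ 6 + C b : ℤ[X])) (hroot : aeval θ (X ^ 6 + C b : ℤ[X]) = 0)
    (hK : IntermediateField.adjoin ℚ {θ} = ⊤) : IsPureSextic θ b := by
  have hpow : θ ^ 6 = -(b : K) := by
    simp only [map_add, map_pow, aeval_X, aeval_C] at hroot
    simpa using eq_neg_of_add_eq_zero_left hroot
  have hm : (X ^ 6 + C b : ℤ[X]).Monic := monic_X_pow_add_C _ (by norm_num)
  have hirr' := (hm.irreducible_iff_irreducible_map_fraction_map (K := ℚ)).1 hirr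
  have hmin := minpoly.eq_of_irreducible_of_monic (x := θ) hirr' (by
    simpa using hroot) (hm.map _)
  have hi : IsIntegral ℚ θ := (isIntegral_of_pow_eq_intCast (n := 6) (m := -b) (by norm_num)
    (by simpa using hpow)).tower_top
  refine ⟨hpow, hK, ?_⟩
  rw [← IntermediateField.finrank_top', ← hK, IntermediateField.adjoin.finrank hi, ← hmin,
    hm.natDegree_map, natDegree_X_pow_add_C]

theorem Nat.factorization_prod_pow_apply {S : Finset ℕ} (hS : ∀ p ∈ S, p.Prime) (f : ℕ → ℕ)
    (q : ℕ) : (∏ p ∈ S, p ^ f p).factorization q = if q ∈ S then f q else 0 := by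
  rw [Nat.factorization_prod fun p hp => pow_ne_zero _ (hS p hp).ne_zero, Finset.sum_apply',
    Finset.sum_congr rfl fun p hp => by rw [(hS p hp).factorization_pow, Finsupp.single_apply]]
  simp

theorem corollary1p3 {K : Type*} [Field K] [NumberField K] (b : ℤ) (θ : K)
    (hirr : Irreducible (Polynomial.X ^ 6 + Polynomial.C b : Polynomial ℤ))
    (hb : ∀ p : ℕ, p.Prime → ¬ (p : ℤ) ^ 6 ∣ b)
    (hroot : Polynomial.aeval θ (Polynomial.X ^ 6 + Polynomial.C b : Polynomial ℤ) = 0)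
    (hK : IntermediateField.adjoin ℚ {θ} = ⊤) :
    NumberField.discr K =
      Int.sign (-b) * 2 ^ expTwo b * 3 ^ expThree b *
        ∏ p ∈ b.natAbs.primeFactors \ {2, 3}, (p : ℤ) ^ (6 - Nat.gcd 6 (padicValInt p b)) := by
  have h := isPureSextic_of_irreducible hirr hroot hK
  have hdisc := NumberField.discr_ne_zero K
  set S := b.natAbs.primeFactors \ {2, 3} with hSdef
  set f : ℕ → ℕ := fun p => 6 - Nat.gcd 6 (padicValInt p b) with hf
  have hS (p : ℕ) (hp : p ∈ S) : p.Prime :=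
    Nat.prime_of_mem_primeFactors (Finset.mem_sdiff.1 hp).1
  have hprod : ∏ p ∈ S, p ^ f p ≠ 0 :=
    Finset.prod_ne_zero_iff.2 fun p hp => pow_ne_zero _ (hS p hp).ne_zero
  have key : (NumberField.discr K).natAbs = 2 ^ expTwo b * 3 ^ expThree b * ∏ p ∈ S, p ^ f p := by
    refine Nat.eq_of_factorization_eq (Int.natAbs_ne_zero.2 hdisc) (by positivity) fun q => ?_
    by_cases hq : q.Prime
    · have : Fact q.Prime := ⟨hq⟩
      rw [Nat.factorization_mul (by positivity) hprod, Nat.factorization_mul (by positivity)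
        (by positivity), Finsupp.add_apply, Finsupp.add_apply,
        Nat.prime_two.factorization_pow, Nat.prime_three.factorization_pow,
        Nat.factorization_prod_pow_apply hS, Finsupp.single_apply, Finsupp.single_apply,
        Nat.factorization_def _ hq]
      change padicValInt q _ = _
      by_cases h2 : q = 2
      · subst h2
        simp [hSdef, h.padicValInt_discr_two (hb 2 hq)]
      by_cases h3 : q = 3
      · subst h3
        simp [hSdef, h.padicValInt_discr_three (hb 3 hq)]
      have h5 : 5 ≤ q := by
        by_contra hlt
        have h2' := hq.two_le
        interval_cases q
        · exact h2 rfl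
        · exact h3 rfl
        · norm_num at hq
      rw [h.padicValInt_discr_of_five_le q h5 (hb q hq), if_neg (Ne.symm h2), if_neg (Ne.symm h3)]
      by_cases hqb : (q : ℤ) ∣ b
      · rw [if_pos]
        · simp [hf]
        · simp [hSdef, hq, Int.natCast_dvd.1 hqb, h.ne_zero, h2, h3]
      -- A prime `q ≥ 5` not dividing `b` has exponent `6 - gcd(6, 0) = 0`, in agreement with its
      -- absence from `S`.
      · simp [hSdef, padicValInt.eq_zero_of_not_dvd hqb, ← Int.natCast_dvd, hqb]
    · rw [Nat.factorization_eq_zero_of_not_prime _ hq, Nat.factorization_eq_zero_of_not_prime _ hq]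
  rw [← Int.sign_mul_natAbs (NumberField.discr K), key, h.sign_discr]
  push_cast
  ring
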